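/- Let $X$ be a connected complex manifold (Hausdorff and second countable) of complex dimension $n$, let $g$ be a $C^\infty$ Hermitian metric on $X$ (that is, in its holomorphic tangent bundle), and let $L$ be a holomorphic line bundle on $X$. For a real $C^2$ function $\varphi$ on an open subset of $X$ put, in local holomorphic coordinates $(z_1,\dots,z_n)$, $$\Delta_g\varphi=\sum_{i,j=1}^n g^{i\bar j}\,\frac{\partial^2\varphi}{\partial z_i\,\partial\bar z_j},\qquad \bigl(g^{i\bar j}\bigr)=\overline{\bigl(g_{i\bar j}\bigr)^{-1}},$$ the trace with respect to $g$ of the Levi form of $\varphi$. For a $C^\infty$ Hermitian metric $h$ in $L$, the scalar curvature $\mathcal R_h$ of $h$ with respect to $g$ is the function on $X$ given locally by $\mathcal R_h=\Delta_g(-\log|s|_h^2)$ for any nonvanishing local holomorphic section $s$ of $L$. Suppose that at least one of the following holds: (a) $X$ is noncompact; (b) $L$ is (isomorphic to) the holomorphic line bundle $[D]$ associated to an effective divisor $D\neq 0$ in $X$; here $D$ is given by holomorphic local defining functions $f_x$, not identically zero on any nonempty open set, on open neighbourhoods $U_x$ of the points $x\in X$, such that all quotients $f_x/f_y$ are nowhere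 vanishing holomorphic functions on $U_x\cap U_y$; $[D]$ is the line bundle with transition functions $f_x/f_y$; and $D\ne 0$ means that some point $x$ satisfies $f_x(x)=0$; (c) $L$ has a global holomorphic section that is not identically zero and vanishes at some point of $X$ (an equivalent form of (b)). Then $L$ admits a $C^\infty$ Hermitian metric $h$ with $\mathcal R_h>0$ everywhere on $X$. -/

import Mathlib

open scoped Manifold ContDiff Bundle ComplexConjugate

noncomputable section

/-- The section of a vector bundle `V` with model fibre `F` that has the constant coordinate `v : F` in
the preferred trivialization at `x₀`. For a holomorphic bundle it is a holomorphic section over the base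
set of that trivialization. For `V` the tangent bundle of a manifold it is the constant vector field `v`
in the chart at `x₀`; for `V` a line bundle and `v = 1` it is a nowhere vanishing local section. -/
def localFrame {X : Type*} [TopologicalSpace X]
    (F : Type*) [NormedAddCommGroup F] [NormedSpace ℂ F]
    (V : X → Type*) [TopologicalSpace (Bundle.TotalSpace F V)]
    [∀ x, AddCommGroup (V x)] [∀ x, TopologicalSpace (V x)] [FiberBundle F V]
    (x₀ : X) (v : F) (y : X) : V y :=
  (trivializationAt F V x₀).symm y v

/-- A `C^∞` Hermitian metric in a complex vector bundle `V` over the manifold `X` (modelled on the complex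
vector space `E`): a Hermitian positive definite form on each fibre, complex linear in the first variable
and conjugate linear in the second, whose coefficients in the local frames of the bundle are `C^∞`
functions in the real sense. -/
structure HermitianMetric (E : Type*) [NormedAddCommGroup E] [NormedSpace ℂ E]
    {X : Type*} [TopologicalSpace X] [ChartedSpace E X]
    (F : Type*) [NormedAddCommGroup F] [NormedSpace ℂ F]
    (V : X → Type*) [TopologicalSpace (Bundle.TotalSpace F V)]
    [∀ x, AddCommGroup (V x)] [∀ x, Module ℂ (V x)] [∀ x, TopologicalSpace (V x)]
    [FiberBundle F V] where
  form : ∀ x : X, V x →ₗ[ℂ] V x →ₗ⋆[ℂ] ℂ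
  conj_symm : ∀ (x : X) (v w : V x), conj (form x v w) = form x w v
  pos : ∀ (x : X) (v : V x), v ≠ 0 → 0 < (form x v v).re
  smooth : ∀ (x₀ : X) (v w : F),
    ContMDiffOn 𝓘(ℝ, E) 𝓘(ℝ, ℂ) ∞
      (fun y => form y (localFrame F V x₀ v y) (localFrame F V x₀ w y))
      (trivializationAt F V x₀).baseSet

/-- The squared norm `|v|²` of a vector in the fibre over `x`. -/
def HermitianMetric.normSq {E : Type*} [NormedAddCommGroup E] [NormedSpace ℂ E]
    {X : Type*} [TopologicalSpace X] [ChartedSpace E X]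
    {F : Type*} [NormedAddCommGroup F] [NormedSpace ℂ F]
    {V : X → Type*} [TopologicalSpace (Bundle.TotalSpace F V)]
    [∀ x, AddCommGroup (V x)] [∀ x, Module ℂ (V x)] [∀ x, TopologicalSpace (V x)]
    [FiberBundle F V] (h : HermitianMetric E F V) {x : X} (v : V x) : ℝ :=
  (h.form x v v).re

/-- The Wirtinger derivative `∂f/∂z` in the direction `v`, namely `(∂_v f - i ∂_{iv} f) / 2`. If `v` is
the `i`-th vector of a basis with coordinates `z₁, …, zₙ`, this is `∂f/∂zᵢ`. -/
def wirtinger {E : Type*} [NormedAddCommGroup E] [NormedSpace ℂ E] (v : E) (f : E → ℂ) (p : E) : ℂ :=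
  (fderiv ℝ f p v - Complex.I * fderiv ℝ f p (Complex.I • v)) / 2

/-- The Wirtinger derivative `∂f/∂z̄` in the direction `v`, namely `(∂_v f + i ∂_{iv} f) / 2`. -/
def wirtingerBar {E : Type*} [NormedAddCommGroup E] [NormedSpace ℂ E] (v : E) (f : E → ℂ) (p : E) : ℂ :=
  (fderiv ℝ f p v + Complex.I * fderiv ℝ f p (Complex.I • v)) / 2

/-- The coefficient matrix `∂²φ/∂zᵢ∂z̄ⱼ` at `x` of the Levi form of `φ`, in the local holomorphic
coordinates `z₁, …, zₙ` that the chart at `x` and the basis `Module.finBasis ℂ E` of `E` define. -/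
def leviMatrix (E : Type*) [NormedAddCommGroup E] [NormedSpace ℂ E] [FiniteDimensional ℂ E]
    {X : Type*} [TopologicalSpace X] [ChartedSpace E X] (φ : X → ℝ) (x : X) :
    Matrix (Fin (Module.finrank ℂ E)) (Fin (Module.finrank ℂ E)) ℂ :=
  Matrix.of fun i j =>
    wirtinger (Module.finBasis ℂ E i)
      (wirtingerBar (Module.finBasis ℂ E j) fun p => ((φ ((chartAt E x).symm p) : ℝ) : ℂ))
      (chartAt E x x)

/-- The coefficient matrix `g(∂/∂zᵢ, ∂/∂zⱼ)` at `x` of a Hermitian metric on the tangent bundle, in the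
same coordinates at `x`. -/
def metricMatrix {E : Type*} [NormedAddCommGroup E] [NormedSpace ℂ E] [FiniteDimensional ℂ E]
    {X : Type*} [TopologicalSpace X] [ChartedSpace E X] [IsManifold 𝓘(ℂ, E) ω X]
    (g : HermitianMetric E E (fun x : X => TangentSpace 𝓘(ℂ, E) x)) (x : X) :
    Matrix (Fin (Module.finrank ℂ E)) (Fin (Module.finrank ℂ E)) ℂ :=
  Matrix.of fun i j =>
    g.form x
      (localFrame E (fun x : X => TangentSpace 𝓘(ℂ, E) x) x (Module.finBasis ℂ E i) x)
      (localFrame E (fun x : X => TangentSpace 𝓘(ℂ, E) x) x (Module.finBasis ℂ E j) x)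

/-- The Laplace operator of the Hermitian metric `g`: the trace `∑ g^{i j̄} ∂²φ/∂zᵢ∂z̄ⱼ` of the Levi form
with respect to `g`, where `(g^{i j̄})` is the complex conjugate of the inverse of `(g_{i j̄})`. For a real
`C²` function both matrices are Hermitian and the sum is real; it does not depend on the coordinates. -/
def hermitianLaplacian {E : Type*} [NormedAddCommGroup E] [NormedSpace ℂ E] [FiniteDimensional ℂ E]
    {X : Type*} [TopologicalSpace X] [ChartedSpace E X] [IsManifold 𝓘(ℂ, E) ω X]
    (g : HermitianMetric E E (fun x : X => TangentSpace 𝓘(ℂ, E) x)) (φ : X → ℝ) (x : X) : ℝ :=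
  (∑ i, ∑ j, conj ((metricMatrix g x)⁻¹ i j) * leviMatrix E φ x i j).re

/-- The scalar curvature of the Hermitian metric `h` in the holomorphic line bundle `L`, with respect to
`g`: the value at `x` of `Δ_g (-log |s|²_h)`, where `s` is a nonvanishing holomorphic section of `L` near
`x` (the value does not depend on `s`, and the frame of `L` at `x` is used). -/
def scalarCurvature {E : Type*} [NormedAddCommGroup E] [NormedSpace ℂ E] [FiniteDimensional ℂ E]
    {X : Type*} [TopologicalSpace X] [ChartedSpace E X] [IsManifold 𝓘(ℂ, E) ω X]
    {L : X → Type*} [TopologicalSpace (Bundle.TotalSpace ℂ L)]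
    [∀ x, AddCommGroup (L x)] [∀ x, Module ℂ (L x)] [∀ x, TopologicalSpace (L x)]
    [FiberBundle ℂ L]
    (g : HermitianMetric E E (fun x : X => TangentSpace 𝓘(ℂ, E) x))
    (h : HermitianMetric E ℂ L) (x : X) : ℝ :=
  hermitianLaplacian g (fun y => -Real.log (h.normSq (localFrame ℂ L x 1 y))) x

/-- The section `s` of the bundle `L` is holomorphic over the set `U`. -/
def IsHolomorphicSectionOn (E : Type*) [NormedAddCommGroup E] [NormedSpace ℂ E]
    {X : Type*} [TopologicalSpace X] [ChartedSpace E X]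
    {L : X → Type*} [TopologicalSpace (Bundle.TotalSpace ℂ L)]
    [∀ x, AddCommGroup (L x)] [∀ x, TopologicalSpace (L x)] [FiberBundle ℂ L]
    (s : ∀ x, L x) (U : Set X) : Prop :=
  ContMDiffOn 𝓘(ℂ, E) (𝓘(ℂ, E).prod 𝓘(ℂ, ℂ)) ω
    (fun y => (Bundle.TotalSpace.mk' ℂ y (s y) : Bundle.TotalSpace ℂ L)) U

/-- An effective divisor on the complex manifold `X`, given by local defining functions: every point `x`
has an open neighbourhood `U x` with a holomorphic function `f x` on it that vanishes identically on no
nonempty open subset, and on each overlap `U x ∩ U y` the quotient `f x / f y` is a nowhere vanishing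
holomorphic function, denoted by `u x y`. -/
structure EffectiveDivisor (E : Type*) [NormedAddCommGroup E] [NormedSpace ℂ E]
    (X : Type*) [TopologicalSpace X] [ChartedSpace E X] where
  U : X → Set X
  isOpen_U : ∀ x, IsOpen (U x)
  mem_U : ∀ x, x ∈ U x
  f : X → X → ℂ
  holomorphic_f : ∀ x, ContMDiffOn 𝓘(ℂ, E) 𝓘(ℂ, ℂ) ω (f x) (U x)
  exists_ne_zero : ∀ x, ∀ W ⊆ U x, IsOpen W → W.Nonempty → ∃ z ∈ W, f x z ≠ 0
  u : X → X → X → ℂ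
  holomorphic_u : ∀ x y, ContMDiffOn 𝓘(ℂ, E) 𝓘(ℂ, ℂ) ω (u x y) (U x ∩ U y)
  u_ne_zero : ∀ x y, ∀ z ∈ U x ∩ U y, u x y z ≠ 0
  f_eq : ∀ x y, ∀ z ∈ U x ∩ U y, f x z = u x y z * f y z

/-- The support of an effective divisor: the common zero set of its local defining functions. -/
def EffectiveDivisor.support {E : Type*} [NormedAddCommGroup E] [NormedSpace ℂ E]
    {X : Type*} [TopologicalSpace X] [ChartedSpace E X] (D : EffectiveDivisor E X) : Set X :=
  {x | D.f x x = 0}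

/-- `L` is (isomorphic to) the holomorphic line bundle `[D]` associated to the divisor `D`, that is, the
line bundle over `X` with the transition functions `f x / f y`: it has holomorphic frames `e x` over
`U x` with `e y = (f x / f y) e x` on `U x ∩ U y`. A section `a x • e x = a y • e y` then satisfies
`a x = (f x / f y) a y`, and in particular the functions `f x` are the coordinates of a global section. -/
def EffectiveDivisor.IsAssociatedLineBundle {E : Type*} [NormedAddCommGroup E] [NormedSpace ℂ E]
    {X : Type*} [TopologicalSpace X] [ChartedSpace E X] (D : EffectiveDivisor E X)
    (L : X → Type*) [TopologicalSpace (Bundle.TotalSpace ℂ L)]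
    [∀ x, AddCommGroup (L x)] [∀ x, Module ℂ (L x)] [∀ x, TopologicalSpace (L x)]
    [FiberBundle ℂ L] : Prop :=
  ∃ e : X → ∀ z, L z,
    (∀ x, IsHolomorphicSectionOn E (e x) (D.U x)) ∧
    (∀ x, ∀ z ∈ D.U x, e x z ≠ 0) ∧
    ∀ x y, ∀ z ∈ D.U x ∩ D.U y, e y z = D.u x y z • e x z

end

/-! Passing from `h` to `e^{-ψ} h` adds `Δ_g ψ` to the scalar curvature
(`scalarCurvature_conformal`), and a smooth metric exists by a partition of unity. The problem is
therefore to find `ψ` with `Δ_g ψ > -R_h`. The operator `Δ_g` is elliptic, has no zeroth order term,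
and satisfies `Δ(χ∘φ) = χ''(φ)|∂φ|² + χ'(φ)Δφ`; no solvability theory for `Δ_g` is used.

The tool is `exists_pushing`: in a connected open set, a smooth function supported there can have `Δ
≥ 0` off a prescribed open set `N` and `Δ > 0` at a chosen point. It is built from Hopf's barrier
`exp(-l|z-c|²)` on coordinate balls, cut off by a convex ramp (`exists_annular_bump`); the negative
part near the centre is absorbed by a function already constructed, so positivity spreads along the
set.

If `X` is noncompact, negativity is pushed off to infinity along an exhaustion whose complements
have no relatively compact components beyond the next stage
(`exists_exhaustion_component_not_subset`). Each correction vanishes on an earlier compact set, so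
the sequence stabilizes locally and `Δ_g ψ` exceeds any given continuous function
(`exists_laplacian_gt_of_noncompactSpace`).

If `X` is compact, negativity cannot be removed by a function alone, but it can be confined to a
small closed set where the section `s` has no zeros. There `-log|s|²_h` is a potential of the
curvature, so adding `log|s|²_h` to the weight cancels the curvature. The section has zeros, so
`log|s|²_h` tends to `-∞` somewhere, and this leaves room for a perturbation `v` with `Δv > 0` off a
neighbourhood `N` of the zeros. With `t = v + C + log|s|²_h` and a convex ramp `χ`, the weight
`χ(t)` gives curvature at least `(1 - χ'(t)) R_h + χ'(t) Δv` off `N`; this is positive, since `χ'(t)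
= 1` wherever `R_h ≤ 0`. On `N` the weight is zero and `R_h` is already positive
(`exists_scalarCurvature_pos_of_pos_outside`). -/

noncomputable section

open scoped Topology ComplexOrder Matrix
open Set Filter

set_option linter.unusedSectionVars false

/-! ### Second derivatives of real functions and the chain rule -/

section Hessian

variable {E E' : Type*} [NormedAddCommGroup E] [NormedSpace ℝ E]
  [NormedAddCommGroup E'] [NormedSpace ℝ E']

/-- The second derivative of a real function, as a bilinear form. -/
def hess (φ : E → ℝ) (p : E) : E →L[ℝ] E →L[ℝ] ℝ := fderiv ℝ (fderiv ℝ φ) p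

theorem ContDiffAt.differentiableAt_fderiv_of_two {φ : E → E'} {p : E} (hφ : ContDiffAt ℝ 2 φ p) :
    DifferentiableAt ℝ (fderiv ℝ φ) p :=
  (hφ.fderiv_right (m := 1) (by norm_num)).differentiableAt (by norm_num)

theorem ContDiffAt.eventually_differentiableAt {φ : E → E'} {p : E} (hφ : ContDiffAt ℝ 2 φ p) :
    ∀ᶠ q in 𝓝 p, DifferentiableAt ℝ φ q :=
  (hφ.eventually (by norm_num)).mono fun _ h => h.differentiableAt (by norm_num)

theorem hess_congr {φ ψ : E → ℝ} {p : E} (h : φ =ᶠ[𝓝 p] ψ) : hess φ p = hess ψ p :=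
  (h.fderiv).fderiv_eq

theorem hess_add {φ ψ : E → ℝ} {p : E} (hφ : ContDiffAt ℝ 2 φ p) (hψ : ContDiffAt ℝ 2 ψ p) :
    hess (fun q => φ q + ψ q) p = hess φ p + hess ψ p := by
  have h : fderiv ℝ (fun q => φ q + ψ q) =ᶠ[𝓝 p] fun q => fderiv ℝ φ q + fderiv ℝ ψ q := by
    filter_upwards [hφ.eventually_differentiableAt, hψ.eventually_differentiableAt] with q h1 h2
    exact fderiv_fun_add h1 h2
  rw [hess, h.fderiv_eq]
  exact fderiv_fun_add hφ.differentiableAt_fderiv_of_two hψ.differentiableAt_fderiv_of_two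

theorem hess_const_mul {φ : E → ℝ} {p : E} (c : ℝ) (hφ : ContDiffAt ℝ 2 φ p) :
    hess (fun q => c * φ q) p = c • hess φ p := by
  have h : fderiv ℝ (fun q => c * φ q) =ᶠ[𝓝 p] fun q => c • fderiv ℝ φ q := by
    filter_upwards [hφ.eventually_differentiableAt] with q h1
    exact fderiv_const_mul h1 c
  rw [hess, h.fderiv_eq]
  exact fderiv_fun_const_smul hφ.differentiableAt_fderiv_of_two c

theorem hess_comp {f : E' → ℝ} {F : E → E'} {p : E} (hf : ContDiffAt ℝ 2 f (F p))
    (hF : ContDiffAt ℝ 2 F p) (v w : E) :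
    hess (fun q => f (F q)) p v w = hess f (F p) (fderiv ℝ F p v) (fderiv ℝ F p w)
      + fderiv ℝ f (F p) (fderiv ℝ (fderiv ℝ F) p v w) := by
  have h : fderiv ℝ (fun q => f (F q)) =ᶠ[𝓝 p] fun q => (fderiv ℝ f (F q)).comp (fderiv ℝ F q) := by
    filter_upwards [hF.eventually_differentiableAt,
      hF.continuousAt.eventually hf.eventually_differentiableAt] with q h1 h2
    exact fderiv_comp q h2 h1
  have h1 : HasFDerivAt (fun q => fderiv ℝ f (F q)) ((hess f (F p)).comp (fderiv ℝ F p)) p :=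
    hf.differentiableAt_fderiv_of_two.hasFDerivAt.comp p
      (hF.differentiableAt (by norm_num)).hasFDerivAt
  have h2 := h1.clm_comp hF.differentiableAt_fderiv_of_two.hasFDerivAt
  rw [hess, h.fderiv_eq, h2.fderiv]
  simp [add_comm]

theorem hess_real_apply (χ : ℝ → ℝ) {t : ℝ} (hχ : ContDiffAt ℝ 2 χ t) (a b : ℝ) :
    hess χ t a b = a * b * deriv (deriv χ) t := by
  have h : (fun s => fderiv ℝ χ s 1) = deriv χ := by ext s; simp
  have h1 : hess χ t 1 1 = deriv (deriv χ) t := by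
    have h2 := hχ.differentiableAt_fderiv_of_two.hasFDerivAt.clm_apply (hasFDerivAt_const (1 : ℝ) t)
    have h3 : HasFDerivAt (deriv χ) _ t := h ▸ h2
    rw [← fderiv_apply_one_eq_deriv, h3.fderiv]
    simp [hess]
  have ha : a = a • (1 : ℝ) := by simp
  have hb : b = b • (1 : ℝ) := by simp
  rw [ha, hb, map_smul, map_smul, smul_apply, h1]
  simp only [smul_eq_mul]; ring

theorem hess_real_comp {χ : ℝ → ℝ} {φ : E → ℝ} {p : E} (hχ : ContDiffAt ℝ 2 χ (φ p))
    (hφ : ContDiffAt ℝ 2 φ p) :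
    hess (fun q => χ (φ q)) p = deriv (deriv χ) (φ p) •
      ((fderiv ℝ φ p).smulRight (fderiv ℝ φ p)) + deriv χ (φ p) • hess φ p := by
  ext v w
  rw [hess_comp hχ hφ, hess_real_apply χ hχ]
  have : fderiv ℝ χ (φ p) (fderiv ℝ (fderiv ℝ φ) p v w)
      = (fderiv ℝ (fderiv ℝ φ) p v w) * deriv χ (φ p) := by
    rw [← fderiv_apply_one_eq_deriv]
    conv_lhs => rw [show fderiv ℝ (fderiv ℝ φ) p v w = (fderiv ℝ (fderiv ℝ φ) p v w) • (1:ℝ) by simp]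
    rw [map_smul]; simp
  rw [this]
  simp [hess]; ring

end Hessian

/-! ### The Levi form and its invariance under holomorphic maps -/

section Levi

variable {E E' : Type*} [NormedAddCommGroup E] [NormedSpace ℂ E]
  [NormedAddCommGroup E'] [NormedSpace ℂ E']

/-- The Levi form of a real bilinear form. -/
def leviForm (B : E →L[ℝ] E →L[ℝ] ℝ) (v w : E) : ℂ :=
  (((B v w + B (Complex.I • v) (Complex.I • w) : ℝ) : ℂ)
    + Complex.I * ((B v (Complex.I • w) - B (Complex.I • v) w : ℝ) : ℂ)) / 4

theorem leviForm_add (B C : E →L[ℝ] E →L[ℝ] ℝ) (v w : E) :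
    leviForm (B + C) v w = leviForm B v w + leviForm C v w := by
  simp [leviForm]; ring

theorem leviForm_smul (c : ℝ) (B : E →L[ℝ] E →L[ℝ] ℝ) (v w : E) :
    leviForm (c • B) v w = c * leviForm B v w := by
  simp [leviForm]; ring

/-- The complex linear part of a real linear form. -/
def complexPart (ξ : E →L[ℝ] ℝ) (v : E) : ℂ := ((ξ v : ℂ) - Complex.I * ξ (Complex.I • v)) / 2

theorem leviForm_smulRight (ξ : E →L[ℝ] ℝ) (v w : E) :
    leviForm (ξ.smulRight ξ) v w = complexPart ξ v * conj (complexPart ξ w) := by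
  simp only [leviForm, complexPart, ContinuousLinearMap.smulRight_apply,
    smul_apply, smul_eq_mul]
  push_cast
  simp only [map_div₀, map_sub, map_mul, Complex.conj_I, Complex.conj_ofReal, map_ofNat]
  linear_combination (ξ (Complex.I • v) * ξ (Complex.I • w) : ℂ) / 4 * Complex.I_sq

theorem continuous_leviForm (v w : E) : Continuous fun B : E →L[ℝ] E →L[ℝ] ℝ => leviForm B v w := by
  have h : ∀ a b : E, Continuous fun B : E →L[ℝ] E →L[ℝ] ℝ => B a b := fun a b =>
    (ContinuousLinearMap.apply ℝ ℝ b).continuous.comp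
      (ContinuousLinearMap.apply ℝ (E →L[ℝ] ℝ) a).continuous
  unfold leviForm
  exact (((Complex.continuous_ofReal.comp ((h _ _).add (h _ _)))).add (continuous_const.mul
    (Complex.continuous_ofReal.comp ((h _ _).sub (h _ _))))).div_const 4

theorem fderiv_ofReal_comp {φ : E → ℝ} {p : E} (hφ : DifferentiableAt ℝ φ p) (v : E) :
    fderiv ℝ (fun q => ((φ q : ℝ) : ℂ)) p v = ((fderiv ℝ φ p v : ℝ) : ℂ) := by
  have := (Complex.ofRealCLM.hasFDerivAt (x := φ p)).comp p hφ.hasFDerivAt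
  have h2 : HasFDerivAt (fun q => ((φ q : ℝ) : ℂ)) (Complex.ofRealCLM.comp (fderiv ℝ φ p)) p := this
  rw [h2.fderiv]; rfl

/-- This turns the iterated Wirtinger derivatives of the definition into algebra on the real
Hessian. Symmetry of the Hessian is not needed: the order of the arguments matches the order of
differentiation. -/
theorem wirtinger_wirtingerBar {φ : E → ℝ} {p : E} (hφ : ContDiffAt ℝ 2 φ p) (v w : E) :
    wirtinger v (wirtingerBar w fun q => ((φ q : ℝ) : ℂ)) p = leviForm (hess φ p) v w := by
  have h : (wirtingerBar w fun q => ((φ q : ℝ) : ℂ)) =ᶠ[𝓝 p]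
      fun q => ((fderiv ℝ φ q w : ℝ) + Complex.I * (fderiv ℝ φ q (Complex.I • w) : ℝ)) / 2 := by
    filter_upwards [hφ.eventually_differentiableAt] with q hq
    simp only [wirtingerBar, fderiv_ofReal_comp hq]
  have key : ∀ u : E, HasFDerivAt (fun q => ((fderiv ℝ φ q u : ℝ) : ℂ))
      (Complex.ofRealCLM.comp ((hess φ p).flip u)) p := by
    intro u
    have h1 := hφ.differentiableAt_fderiv_of_two.hasFDerivAt.clm_apply (hasFDerivAt_const u p)
    have h2 := (Complex.ofRealCLM.hasFDerivAt (x := fderiv ℝ φ p u)).comp p h1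
    refine HasFDerivAt.congr_fderiv (f := fun q => ((fderiv ℝ φ q u : ℝ) : ℂ)) h2 ?_
    ext; simp [hess]
  have h3 := (((key w).add ((key (Complex.I • w)).const_mul Complex.I)).mul_const (2⁻¹ : ℂ))
  have h4 := h3.congr_of_eventuallyEq (f₁ := fun q => ((fderiv ℝ φ q w : ℝ)
      + Complex.I * (fderiv ℝ φ q (Complex.I • w) : ℝ)) / 2)
    (Eventually.of_forall fun q => by simp [div_eq_mul_inv])
  rw [wirtinger, h.fderiv_eq, h4.fderiv]
  simp only [leviForm, smul_apply, add_apply,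
    ContinuousLinearMap.comp_apply, ContinuousLinearMap.flip_apply, Complex.ofRealCLM_apply,
    smul_eq_mul]
  push_cast
  linear_combination (-(hess φ p (Complex.I • v) (Complex.I • w)) / 4 : ℂ) * Complex.I_sq

/-- The first derivative is complex linear at every point near `p`, and this identity can be
differentiated. Complex bilinearity of the second derivative is what makes the second-order term of
the chain rule drop out of the Levi form. -/
theorem fderiv_fderiv_smul_right {F : E → E'} {p : E} (hF : ContDiffAt ℂ 2 F p) (v w : E) :
    fderiv ℝ (fderiv ℝ F) p v (Complex.I • w) = Complex.I • fderiv ℝ (fderiv ℝ F) p v w := by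
  have hR : ContDiffAt ℝ 2 F p := hF.restrict_scalars ℝ
  have hd := hR.differentiableAt_fderiv_of_two.hasFDerivAt
  have h1 := hd.clm_apply (hasFDerivAt_const (Complex.I • w) p)
  have h2 := (hd.clm_apply (hasFDerivAt_const w p)).const_smul Complex.I
  have h : (fun q => fderiv ℝ F q (Complex.I • w)) =ᶠ[𝓝 p] fun q => Complex.I • fderiv ℝ F q w := by
    filter_upwards [hF.eventually (by norm_num)] with q hq
    have : DifferentiableAt ℂ F q := hq.differentiableAt (by norm_num)
    rw [this.fderiv_restrictScalars ℝ]
    simp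
  have h3 := (h1.congr_of_eventuallyEq h.symm).unique h2
  simpa using congrArg (fun L => L v) h3

theorem fderiv_fderiv_smul_left {F : E → E'} {p : E} (hF : ContDiffAt ℂ 2 F p) (v w : E) :
    fderiv ℝ (fderiv ℝ F) p (Complex.I • v) w = Complex.I • fderiv ℝ (fderiv ℝ F) p v w := by
  have hR : ContDiffAt ℝ 2 F p := hF.restrict_scalars ℝ
  have hs : IsSymmSndFDerivAt ℝ F p := hR.isSymmSndFDerivAt (by simp)
  rw [hs.eq, fderiv_fderiv_smul_right hF, hs.eq]

/-- The Levi form is invariant under holomorphic maps. -/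
theorem leviForm_hess_comp {f : E' → ℝ} {F : E → E'} {p : E} (hf : ContDiffAt ℝ 2 f (F p))
    (hF : ContDiffAt ℂ 2 F p) (v w : E) :
    leviForm (hess (fun q => f (F q)) p) v w
      = leviForm (hess f (F p)) (fderiv ℂ F p v) (fderiv ℂ F p w) := by
  have hR : ContDiffAt ℝ 2 F p := hF.restrict_scalars ℝ
  have hd : DifferentiableAt ℂ F p := hF.differentiableAt (by norm_num)
  have e : ∀ u, fderiv ℝ F p u = fderiv ℂ F p u := fun u => by
    rw [hd.fderiv_restrictScalars ℝ]; rfl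
  simp only [leviForm, hess_comp hf hR, e, fderiv_fderiv_smul_right hF, fderiv_fderiv_smul_left hF,
    smul_smul, Complex.I_mul_I, map_smul, neg_smul, one_smul, map_neg]
  push_cast
  ring

theorem leviForm_hess_re {F : E → ℂ} {p : E} (hF : ContDiffAt ℂ 2 F p) (v w : E) :
    leviForm (hess (fun q => (F q).re) p) v w = 0 := by
  have h : hess (fun z : ℂ => z.re) = 0 := by
    ext z : 1
    have : fderiv ℝ (fun z : ℂ => z.re) = fun _ => Complex.reCLM := by
      ext z : 1; exact Complex.reCLM.fderiv
    rw [hess, this, fderiv_fun_const]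
  have h2 := leviForm_hess_comp (f := fun z : ℂ => z.re) (F := F) (p := p)
    (Complex.reCLM.contDiff.contDiffAt) hF v w
  rw [h2, h]; simp [leviForm]

/-- The logarithm of the modulus of a nonvanishing holomorphic function is pluriharmonic. -/
theorem leviForm_hess_log_normSq {F : E → ℂ} {p : E} (hF : ContDiffAt ℂ 2 F p) (h0 : F p ≠ 0)
    (v w : E) : leviForm (hess (fun q => Real.log (Complex.normSq (F q))) p) v w = 0 := by
  -- Scaling by `c` moves the value at `p` to `1`, inside the slit plane, so the principal logarithm
  -- is holomorphic there; the scaling costs only an additive constant.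
  set c : ℂ := (F p)⁻¹ with hc
  have hc0 : c ≠ 0 := inv_ne_zero h0
  have hs : c * F p ∈ Complex.slitPlane := by simp [hc, h0]
  have hFc : ContDiffAt ℂ 2 (fun q => c * F q) p := contDiffAt_const.mul hF
  have hG : ContDiffAt ℂ 2 (fun q => Complex.log (c * F q)) p :=
    ContDiffAt.comp (g := Complex.log) p (Complex.contDiffAt_log hs) hFc
  have hR : ContDiffAt ℂ 2 (fun q => 2 * Complex.log (c * F q) - Real.log (Complex.normSq c)) p :=
    (contDiffAt_const.mul hG).sub contDiffAt_const
  have h : (fun q => Real.log (Complex.normSq (F q))) =ᶠ[𝓝 p]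
      fun q => (2 * Complex.log (c * F q) - Real.log (Complex.normSq c)).re := by
    filter_upwards [hF.continuousAt.eventually_ne h0] with q hq
    have : Complex.normSq c ≠ 0 := by simpa using hc0
    have h2 : Complex.normSq (F q) ≠ 0 := by simpa using hq
    rw [Complex.sub_re, Complex.ofReal_re, Complex.mul_re]
    simp only [Complex.re_ofNat, Complex.im_ofNat, zero_mul, sub_zero, Complex.log_re, norm_mul]
    have e1 : ∀ z : ℂ, Real.log (Complex.normSq z) = 2 * Real.log ‖z‖ := fun z => by
      rw [Complex.normSq_eq_norm_sq, Real.log_pow]; norm_num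
    rw [Real.log_mul (by simpa using hc0) (by simpa using hq), e1, e1]; ring
  rw [hess_congr h]
  exact leviForm_hess_re hR v w

end Levi

/-! ### The trace of the Levi form: positivity, invariance, continuity -/

section Contraction

variable {E : Type*} [NormedAddCommGroup E] [NormedSpace ℂ E] [FiniteDimensional ℂ E]

/-- Square complex matrices indexed by the coordinates of `E`. -/
abbrev CoordMatrix (E : Type*) [NormedAddCommGroup E] [NormedSpace ℂ E] :=
  Matrix (Fin (Module.finrank ℂ E)) (Fin (Module.finrank ℂ E)) ℂ

/-- The trace of the Levi form of a real bilinear form with respect to the Hermitian matrix `G`. -/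
def leviTrace (G : CoordMatrix E) (B : E →L[ℝ] E →L[ℝ] ℝ) : ℝ :=
  (∑ i, ∑ j, conj (G⁻¹ i j) * leviForm B (Module.finBasis ℂ E i) (Module.finBasis ℂ E j)).re

theorem leviTrace_add (G : CoordMatrix E) (B C : E →L[ℝ] E →L[ℝ] ℝ) :
    leviTrace G (B + C) = leviTrace G B + leviTrace G C := by
  simp only [leviTrace, leviForm_add, mul_add, Finset.sum_add_distrib, Complex.add_re]

theorem leviTrace_smul (G : CoordMatrix E) (c : ℝ) (B : E →L[ℝ] E →L[ℝ] ℝ) :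
    leviTrace G (c • B) = c * leviTrace G B := by
  simp only [leviTrace, leviForm_smul, mul_left_comm _ (c : ℂ), ← Finset.mul_sum,
    Complex.re_ofReal_mul]

theorem leviTrace_eq_zero (G : CoordMatrix E) (B : E →L[ℝ] E →L[ℝ] ℝ)
    (h : ∀ v w, leviForm B v w = 0) : leviTrace G B = 0 := by
  simp [leviTrace, h]

theorem leviTrace_smulRight (G : CoordMatrix E) (ξ : E →L[ℝ] ℝ) :
    leviTrace G (ξ.smulRight ξ) =
      (star (fun i => complexPart ξ (Module.finBasis ℂ E i)) ⬝ᵥ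
        (G⁻¹ *ᵥ fun i => complexPart ξ (Module.finBasis ℂ E i))).re := by
  rw [leviTrace, ← Complex.conj_re]
  congr 1
  simp only [leviForm_smulRight, map_sum, map_mul, dotProduct, Matrix.mulVec, Finset.mul_sum,
    Complex.conj_conj, Pi.star_apply]
  refine Finset.sum_congr rfl fun i _ => Finset.sum_congr rfl fun j _ => ?_
  simp only [RCLike.star_def]; ring

/-- Degenerate ellipticity: on a rank one form `ξ ⊗ ξ` the trace is the value of the positive
definite inverse matrix on the complex part of `ξ`. -/
theorem leviTrace_smulRight_nonneg {G : CoordMatrix E} (hG : G.PosDef)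
    (ξ : E →L[ℝ] ℝ) : 0 ≤ leviTrace G (ξ.smulRight ξ) := by
  rw [leviTrace_smulRight]
  exact hG.inv.posSemidef.re_dotProduct_nonneg _

/-- The real and imaginary parts of the complex part recover `ξ` on the vectors `b i` and `I • b i`,
which span `E` over `ℝ`. This makes the ellipticity strict for `ξ ≠ 0`. -/
theorem eq_zero_of_complexPart_eq_zero {ξ : E →L[ℝ] ℝ}
    (h : ∀ i, complexPart ξ (Module.finBasis ℂ E i) = 0) : ξ = 0 := by
  have h2 : ∀ i, ξ (Module.finBasis ℂ E i) = 0 ∧ ξ (Complex.I • Module.finBasis ℂ E i) = 0 := by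
    intro i
    have h1 := h i
    simp only [complexPart, div_eq_zero_iff, OfNat.ofNat_ne_zero, or_false] at h1
    have a := congrArg Complex.re h1
    have b := congrArg Complex.im h1
    simp at a b
    exact ⟨a, b⟩
  ext v
  rw [← (Module.finBasis ℂ E).sum_repr v, map_sum]
  refine Finset.sum_eq_zero fun i _ => ?_
  set c := (Module.finBasis ℂ E).repr v i
  have : c • Module.finBasis ℂ E i = c.re • Module.finBasis ℂ E i
      + c.im • (Complex.I • Module.finBasis ℂ E i) := by
    conv_lhs => rw [← Complex.re_add_im c, add_smul, mul_smul]
    simp [Complex.coe_smul]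
  rw [this, map_add, map_smul, map_smul, (h2 i).1, (h2 i).2]; simp

theorem leviTrace_smulRight_pos {G : CoordMatrix E} (hG : G.PosDef)
    {ξ : E →L[ℝ] ℝ} (hξ : ξ ≠ 0) : 0 < leviTrace G (ξ.smulRight ξ) := by
  rw [leviTrace_smulRight]
  refine hG.inv.re_dotProduct_pos fun h => hξ ?_
  exact eq_zero_of_complexPart_eq_zero fun i => congrFun h i

theorem leviTrace_eq_trace (G : CoordMatrix E) (B : E →L[ℝ] E →L[ℝ] ℝ) :
    leviTrace G B = (((G⁻¹)ᴴ * Matrix.of fun i j =>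
      leviForm B (Module.finBasis ℂ E i) (Module.finBasis ℂ E j)).trace).re := by
  rw [leviTrace, Matrix.trace, Finset.sum_comm]
  simp [Matrix.mul_apply]

/-- The trace of the Levi form does not depend on the frame. -/
theorem leviTrace_congr {G G' A : CoordMatrix E} {B B' : E →L[ℝ] E →L[ℝ] ℝ}
    (hA : IsUnit A.det) (hG : G' = Aᵀ * G * A.map conj)
    (hB : (Matrix.of fun i j => leviForm B' (Module.finBasis ℂ E i) (Module.finBasis ℂ E j))
      = Aᵀ * (Matrix.of fun i j => leviForm B (Module.finBasis ℂ E i) (Module.finBasis ℂ E j))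
        * A.map conj) :
    leviTrace G' B' = leviTrace G B := by
  rw [leviTrace_eq_trace, leviTrace_eq_trace, hB, hG]
  have e : A.map conj = Aᵀᴴ := by ext; simp
  have hT : IsUnit Aᵀ.det := by rwa [Matrix.det_transpose]
  rw [e, Matrix.mul_inv_rev, Matrix.mul_inv_rev, Matrix.conjTranspose_mul, Matrix.conjTranspose_mul,
    Matrix.conjTranspose_nonsing_inv (Aᵀᴴ), Matrix.conjTranspose_conjTranspose,
    Matrix.trace_mul_comm]
  generalize (Matrix.of fun i j => leviForm B (Module.finBasis ℂ E i) (Module.finBasis ℂ E j)) = M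
  have hT' : IsUnit (Aᵀᴴ).det := by rw [Matrix.det_conjTranspose]; exact hT.star
  have e2 : Aᵀ * M * Aᵀᴴ * ((Aᵀ⁻¹)ᴴ * (G⁻¹)ᴴ * Aᵀ⁻¹) = Aᵀ * (M * (G⁻¹)ᴴ) * Aᵀ⁻¹ := by
    rw [Matrix.conjTranspose_nonsing_inv]
    simp only [Matrix.mul_assoc]
    rw [Matrix.mul_nonsing_inv_cancel_left _ _ hT']
  rw [Matrix.mul_assoc ((Aᵀ⁻¹)ᴴ), ← Matrix.mul_assoc ((Aᵀ⁻¹)ᴴ)]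
  rw [e2, Matrix.trace_mul_comm, ← Matrix.mul_assoc, Matrix.nonsing_inv_mul _ hT, Matrix.one_mul,
    Matrix.trace_mul_comm]

theorem continuousAt_leviTrace {T : Type*} [TopologicalSpace T]
    {G : T → CoordMatrix E} {B : T → E →L[ℝ] E →L[ℝ] ℝ} {t : T}
    (hG : ContinuousAt G t) (hdet : (G t).det ≠ 0) (hB : ContinuousAt B t) :
    ContinuousAt (fun s => leviTrace (G s) (B s)) t := by
  have hi : ContinuousAt (fun s => (G s)⁻¹) t := by
    simp only [Matrix.inv_def, Ring.inverse_eq_inv']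
    have h1 : ContinuousAt (fun s => (G s).det) t :=
      (continuous_id.matrix_det).continuousAt.comp hG
    have h2 : ContinuousAt (fun s => (G s).adjugate) t :=
      (continuous_id.matrix_adjugate).continuousAt.comp hG
    exact (h1.inv₀ hdet).smul h2
  unfold leviTrace
  refine Complex.continuous_re.continuousAt.comp ?_
  refine tendsto_finsetSum _ fun i _ => tendsto_finsetSum _ fun j _ => ?_
  refine ContinuousAt.mul ?_ ((continuous_leviForm _ _).continuousAt.comp hB)
  refine Complex.continuous_conj.continuousAt.comp ?_
  exact (continuous_apply_apply i j).continuousAt.comp hi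

end Contraction

theorem two_le_infty : (2 : ℕ∞ω) ≤ ∞ := by
  exact WithTop.coe_le_coe.2 (le_top : (2 : ℕ∞) ≤ ⊤)

/-! ### Smoothness in charts and the frames of the tangent bundle -/

section ComplexManifold

variable {E : Type*} [NormedAddCommGroup E] [NormedSpace ℂ E]
  {X : Type*} [TopologicalSpace X] [ChartedSpace E X] [IsManifold 𝓘(ℂ, E) ω X]

/-- A complex manifold is a smooth real manifold. -/
instance isManifold_real_of_complex : IsManifold 𝓘(ℝ, E) ∞ X := by
  refine isManifold_of_contDiffOn 𝓘(ℝ, E) ∞ X fun e e' he he' => ?_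
  have h := ModelWithCorners.contDiffOn_extendCoordChange (I := 𝓘(ℂ, E)) (n := ω)
    (IsManifold.subset_maximalAtlas he) (IsManifold.subset_maximalAtlas he')
  have h2 : ContDiffOn ℝ ∞ (e' ∘ e.symm) (e.symm ≫ₕ e').source := by
    refine ((h.restrict_scalars ℝ).of_le le_top).congr_mono (fun _ _ => by simp) ?_
    simp
  simpa using h2

theorem contMDiffAt_iff_contDiffAt_chart {F : Type*} [NormedAddCommGroup F] [NormedSpace ℝ F]
    {φ : X → F} {x₀ x : X} (hx : x ∈ (chartAt E x₀).source) :
    ContMDiffAt 𝓘(ℝ, E) 𝓘(ℝ, F) ∞ φ x ↔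
      ContDiffAt ℝ ∞ (fun p => φ ((chartAt E x₀).symm p)) (chartAt E x₀ x) := by
  rw [contMDiffAt_iff_of_mem_source (x := x₀) (y := φ x) hx (by simp)]
  simp only [mfld_simps, modelWithCornersSelf_coe, range_id, contDiffWithinAt_univ]
  refine ⟨fun h => h.2, fun h => ⟨?_, h⟩⟩
  have h1 : ContinuousAt (fun y => φ ((chartAt E x₀).symm (chartAt E x₀ y))) x :=
    ContinuousAt.comp (g := fun p => φ ((chartAt E x₀).symm p)) h.continuousAt
      ((chartAt E x₀).continuousAt hx)
  refine h1.congr ?_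
  filter_upwards [(chartAt E x₀).open_source.mem_nhds hx] with y hy
  rw [(chartAt E x₀).left_inv hy]

theorem contDiffAt_chart_of_holomorphic {F : Type*} [NormedAddCommGroup F] [NormedSpace ℂ F]
    {f : X → F} {x₀ x : X} (hx : x ∈ (chartAt E x₀).source)
    (hf : ContMDiffAt 𝓘(ℂ, E) 𝓘(ℂ, F) ω f x) :
    ContDiffAt ℂ ω (fun p => f ((chartAt E x₀).symm p)) (chartAt E x₀ x) := by
  have h := ((contMDiffAt_iff_of_mem_source (x := x₀) (y := f x) hx (by simp)).1 hf).2
  simp only [mfld_simps, modelWithCornersSelf_coe, range_id, contDiffWithinAt_univ] at h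
  exact h

theorem ContMDiffAt.real_of_holomorphic {F : Type*} [NormedAddCommGroup F] [NormedSpace ℂ F]
    {f : X → F} {x : X} (hf : ContMDiffAt 𝓘(ℂ, E) 𝓘(ℂ, F) ω f x) :
    ContMDiffAt 𝓘(ℝ, E) 𝓘(ℝ, F) ∞ f x :=
  (contMDiffAt_iff_contDiffAt_chart (mem_chart_source E x)).2
    (((contDiffAt_chart_of_holomorphic (mem_chart_source E x) hf).restrict_scalars ℝ).of_le le_top)

theorem tangent_localFrame_eq {x₀ x y : X} (hx₀ : y ∈ (chartAt E x₀).source)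
    (hx : y ∈ (chartAt E x).source) (v : E) :
    localFrame E (fun x : X => TangentSpace 𝓘(ℂ, E) x) x v y
      = localFrame E (fun x : X => TangentSpace 𝓘(ℂ, E) x) x₀ (tangentCoordChange 𝓘(ℂ, E) x x₀ y v) y := by
  -- Every frame vector at `y` is compared with the frame of the chart at `y` itself; the cocycle
  -- rule for coordinate changes then relates two arbitrary charts.
  have key : ∀ z : X, y ∈ (chartAt E z).source → ∀ w : E,
      localFrame E (fun x : X => TangentSpace 𝓘(ℂ, E) x) z w y
        = tangentCoordChange 𝓘(ℂ, E) z y y w := by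
    intro z hz w
    have h := TangentBundle.symmL_trivializationAt_eq_core (I := 𝓘(ℂ, E)) hz
    have h2 := Bundle.Trivialization.symmL_apply (R := ℂ)
      (trivializationAt E (TangentSpace 𝓘(ℂ, E)) z) (b := y) (by simpa using hz) w
    rw [h] at h2
    exact h2.symm
  rw [key x hx, key x₀ hx₀]
  exact (tangentCoordChange_comp (I := 𝓘(ℂ, E)) (by simp [hx, hx₀])).symm

theorem tangent_localFrame_sum {x₀ x : X} (hx : x ∈ (chartAt E x₀).source) {ι : Type*}
    (s : Finset ι) (c : ι → ℂ) (v : ι → E) :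
    localFrame E (fun x : X => TangentSpace 𝓘(ℂ, E) x) x₀ (∑ i ∈ s, c i • v i) x
      = ∑ i ∈ s, c i • localFrame E (fun x : X => TangentSpace 𝓘(ℂ, E) x) x₀ (v i) x := by
  have h2 := Bundle.Trivialization.symmL_apply (R := ℂ)
      (trivializationAt E (TangentSpace 𝓘(ℂ, E)) x₀) (b := x) (by simpa using hx)
  simp only [localFrame]
  erw [← h2]
  rw [map_sum]
  refine Finset.sum_congr rfl fun i _ => ?_
  rw [map_smul, h2]

theorem tangent_localFrame_ne_zero {x₀ x : X} (hx : x ∈ (chartAt E x₀).source) {v : E}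
    (hv : v ≠ 0) : localFrame E (fun x : X => TangentSpace 𝓘(ℂ, E) x) x₀ v x ≠ 0 := by
  intro h
  have hb : x ∈ (trivializationAt E (TangentSpace 𝓘(ℂ, E)) x₀).baseSet := by simpa using hx
  have h3 := (trivializationAt E (TangentSpace 𝓘(ℂ, E)) x₀).continuousLinearMapAt_symmL
    (R := ℂ) hb v
  rw [Bundle.Trivialization.symmL_apply (R := ℂ) _ hb] at h3
  have h' : (trivializationAt E (TangentSpace 𝓘(ℂ, E)) x₀).symm x v = 0 := h
  rw [h', map_zero] at h3
  exact hv h3.symm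

end ComplexManifold

/-! ### Sesquilinearity of the Levi form -/

section LeviSesquilinear

variable {E : Type*} [NormedAddCommGroup E] [NormedSpace ℂ E]

theorem leviForm_smul_left (B : E →L[ℝ] E →L[ℝ] ℝ) (c : ℂ) (v w : E) :
    leviForm B (c • v) w = c * leviForm B v w := by
  have h : ∀ u : E, c • u = c.re • u + c.im • (Complex.I • u) := fun u => by
    conv_lhs => rw [← Complex.re_add_im c, add_smul, mul_smul]
    simp [Complex.coe_smul]
  have h2 : Complex.I • (c • v) = c.re • (Complex.I • v) + c.im • (-v) := by
    rw [smul_comm, h, smul_smul Complex.I Complex.I, Complex.I_mul_I, neg_one_smul]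
  conv_rhs => rw [← Complex.re_add_im c]
  rw [leviForm, h2, h v]
  simp only [leviForm, map_add, map_smul, add_apply, smul_apply, map_neg, neg_apply, smul_eq_mul]
  push_cast
  linear_combination (c.im : ℂ) *
    (-((B v) (Complex.I • w) : ℂ) + B (Complex.I • v) w) / 4 * Complex.I_sq

theorem leviForm_smul_right (B : E →L[ℝ] E →L[ℝ] ℝ) (c : ℂ) (v w : E) :
    leviForm B v (c • w) = conj c * leviForm B v w := by
  have h : ∀ u : E, c • u = c.re • u + c.im • (Complex.I • u) := fun u => by
    conv_lhs => rw [← Complex.re_add_im c, add_smul, mul_smul]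
    simp [Complex.coe_smul]
  have h2 : Complex.I • (c • w) = c.re • (Complex.I • w) + c.im • (-w) := by
    rw [smul_comm, h, smul_smul Complex.I Complex.I, Complex.I_mul_I, neg_one_smul]
  have h3 : conj c = c.re - c.im * Complex.I := by
    conv_lhs => rw [← Complex.re_add_im c]
    rw [map_add, map_mul, Complex.conj_I, Complex.conj_ofReal, Complex.conj_ofReal]; ring
  rw [h3, leviForm, h2, h w]
  simp only [leviForm, map_add, map_smul, map_neg, smul_eq_mul]
  push_cast
  linear_combination (c.im : ℂ) *
    (((B v) (Complex.I • w) : ℂ) - B (Complex.I • v) w) / 4 * Complex.I_sq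

theorem leviForm_sum_left (B : E →L[ℝ] E →L[ℝ] ℝ) {ι : Type*} (s : Finset ι) (v : ι → E) (w : E) :
    leviForm B (∑ i ∈ s, v i) w = ∑ i ∈ s, leviForm B (v i) w := by
  simp only [leviForm, Finset.smul_sum, map_sum, sum_apply, ← Finset.sum_add_distrib,
    ← Finset.sum_sub_distrib, Complex.ofReal_sum, Finset.mul_sum, Finset.sum_div]

theorem leviForm_sum_right (B : E →L[ℝ] E →L[ℝ] ℝ) {ι : Type*} (s : Finset ι) (v : E) (w : ι → E) :
    leviForm B v (∑ i ∈ s, w i) = ∑ i ∈ s, leviForm B v (w i) := by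
  simp only [leviForm, Finset.smul_sum, map_sum, ← Finset.sum_add_distrib,
    ← Finset.sum_sub_distrib, Complex.ofReal_sum, Finset.mul_sum, Finset.sum_div]

end LeviSesquilinear

/-! ### Independence of the Laplacian from the chart -/

section Laplacian

variable {E : Type*} [NormedAddCommGroup E] [NormedSpace ℂ E] [FiniteDimensional ℂ E]
  {X : Type*} [TopologicalSpace X] [ChartedSpace E X] [IsManifold 𝓘(ℂ, E) ω X]
  (g : HermitianMetric E E (fun x : X => TangentSpace 𝓘(ℂ, E) x))

/-- The coefficient matrix at `x` of a Hermitian metric in the coordinates of the chart at `x₀`. -/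
def frameMatrix (x₀ x : X) : CoordMatrix E :=
  Matrix.of fun i j =>
    g.form x
      (localFrame E (fun x : X => TangentSpace 𝓘(ℂ, E) x) x₀ (Module.finBasis ℂ E i) x)
      (localFrame E (fun x : X => TangentSpace 𝓘(ℂ, E) x) x₀ (Module.finBasis ℂ E j) x)

theorem metricMatrix_eq_frameMatrix (x : X) : metricMatrix g x = frameMatrix g x x := rfl

theorem HermitianMetric.form_sum {F : Type*} [NormedAddCommGroup F] [NormedSpace ℂ F]
    {V : X → Type*} [TopologicalSpace (Bundle.TotalSpace F V)] [∀ x, AddCommGroup (V x)]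
    [∀ x, Module ℂ (V x)] [∀ x, TopologicalSpace (V x)] [FiberBundle F V]
    (h : HermitianMetric E F V) {x : X} {ι : Type*} (s : Finset ι) (c d : ι → ℂ) (v w : ι → V x) :
    h.form x (∑ i ∈ s, c i • v i) (∑ j ∈ s, d j • w j)
      = ∑ i ∈ s, ∑ j ∈ s, c i * conj (d j) * h.form x (v i) (w j) := by
  simp only [map_sum, map_smul, LinearMap.sum_apply, map_smulₛₗ, LinearMap.smul_apply, smul_eq_mul,
    Finset.mul_sum]
  rw [Finset.sum_comm]
  refine Finset.sum_congr rfl fun i _ => Finset.sum_congr rfl fun j _ => ?_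
  ring

theorem frameMatrix_posDef {x₀ x : X} (hx : x ∈ (chartAt E x₀).source) :
    (frameMatrix g x₀ x).PosDef := by
  refine Matrix.PosDef.of_dotProduct_mulVec_pos ?_ fun c hc => ?_
  · ext i j
    simp only [frameMatrix, Matrix.conjTranspose_apply, Matrix.of_apply]
    exact g.conj_symm _ _ _
  -- The coefficients are conjugated because `g` is linear in the first variable, whereas the matrix
  -- quadratic form conjugates its left vector.
  · set w : TangentSpace 𝓘(ℂ, E) x := localFrame E (fun x : X => TangentSpace 𝓘(ℂ, E) x) x₀
      (∑ i, conj (c i) • Module.finBasis ℂ E i) x with hw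
    have hw0 : w ≠ 0 := by
      refine tangent_localFrame_ne_zero hx fun h => hc ?_
      have h1 := Fintype.linearIndependent_iff.1 (Module.finBasis ℂ E).linearIndependent _ h
      ext i
      simpa using h1 i
    have hs : star c ⬝ᵥ (frameMatrix g x₀ x) *ᵥ c = g.form x w w := by
      rw [hw, tangent_localFrame_sum hx, g.form_sum]
      simp only [dotProduct, Matrix.mulVec, frameMatrix, Matrix.of_apply, Pi.star_apply,
        RCLike.star_def, Finset.mul_sum, Complex.conj_conj]
      refine Finset.sum_congr rfl fun i _ => Finset.sum_congr rfl fun j _ => ?_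
      ring
    rw [hs, Complex.lt_def]
    refine ⟨g.pos x w hw0, ?_⟩
    have := congrArg Complex.im (g.conj_symm x w w)
    simp only [Complex.conj_im] at this
    simp only [Complex.zero_im]
    linarith

theorem continuousOn_frameMatrix (x₀ : X) :
    ContinuousOn (frameMatrix g x₀) (chartAt E x₀).source := by
  refine continuousOn_pi.2 fun i => continuousOn_pi.2 fun j => ?_
  have h := (g.smooth x₀ (Module.finBasis ℂ E i) (Module.finBasis ℂ E j)).continuousOn
  rwa [TangentBundle.trivializationAt_baseSet] at h

/-- The Laplacian in the coordinates of an arbitrary preferred chart. -/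
theorem hermitianLaplacian_eq_leviTrace {φ : X → ℝ} {x₀ x : X} (hx : x ∈ (chartAt E x₀).source)
    (hφ : ContMDiffAt 𝓘(ℝ, E) 𝓘(ℝ, ℝ) ∞ φ x) :
    hermitianLaplacian g φ x = leviTrace (frameMatrix g x₀ x)
      (hess (fun p => φ ((chartAt E x₀).symm p)) (chartAt E x₀ x)) := by
  have hxx := mem_chart_source E x
  have h1 := ((contMDiffAt_iff_contDiffAt_chart hxx).1 hφ).of_le
    two_le_infty
  have h2 := ((contMDiffAt_iff_contDiffAt_chart hx).1 hφ).of_le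
    two_le_infty
  have e1 : hermitianLaplacian g φ x = leviTrace (frameMatrix g x x)
      (hess (fun p => φ ((chartAt E x).symm p)) (chartAt E x x)) := by
    rw [hermitianLaplacian, leviTrace, metricMatrix_eq_frameMatrix]
    simp only [leviMatrix, Matrix.of_apply, wirtinger_wirtingerBar h1]
  rw [e1]
  set p := chartAt E x x with hp
  set F : E → E := fun q => chartAt E x₀ ((chartAt E x).symm q) with hFdef
  have hFp : F p = chartAt E x₀ x := by rw [hFdef, hp]; simp
  have hF : ContDiffAt ℂ ω F p := by
    have := contDiffWithinAt_ext_coord_change (I := 𝓘(ℂ, E)) (n := ω) x₀ x (y := p)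
      (by simp [hp, hx])
    simpa [contDiffWithinAt_univ, Function.comp_def] using this
  have hF2 : ContDiffAt ℂ 2 F p := hF.of_le le_top
  set T := tangentCoordChange 𝓘(ℂ, E) x x₀ x with hT
  have hTF : T = fderiv ℂ F p := by
    rw [hT, tangentCoordChange_def]
    simp [Function.comp_def, hFdef, hp]
  have hcomp : (fun q => φ ((chartAt E x).symm q)) =ᶠ[𝓝 p]
      fun q => (fun q => φ ((chartAt E x₀).symm q)) (F q) := by
    have ho : ((chartAt E x).symm ⁻¹' (chartAt E x₀).source) ∈ 𝓝 p :=
      ((chartAt E x).continuousAt_symm (mem_chart_target E x)).preimage_mem_nhds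
        ((chartAt E x₀).open_source.mem_nhds (by simpa [hp] using hx))
    filter_upwards [ho] with q hq
    simp only [hFdef]
    rw [(chartAt E x₀).left_inv hq]
  have hlevi : ∀ v w, leviForm (hess (fun q => φ ((chartAt E x).symm q)) p) v w
      = leviForm (hess (fun q => φ ((chartAt E x₀).symm q)) (chartAt E x₀ x)) (T v) (T w) := by
    intro v w
    rw [hess_congr hcomp, leviForm_hess_comp (f := fun q => φ ((chartAt E x₀).symm q))
      (by rwa [hFp]) hF2, hFp, hTF]
  set b := Module.finBasis ℂ E with hb
  -- `A` is the Jacobian matrix of the chart change. The metric matrix and the Levi matrix both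
  -- transform by `M ↦ Aᵀ M Ā`, which is the hypothesis of `leviTrace_congr`.
  set A : CoordMatrix E :=
    LinearMap.toMatrix b b T.toLinearMap with hA
  have hTb : ∀ i, T (b i) = ∑ k, A k i • b k := by
    intro i
    rw [← b.sum_repr (T (b i))]
    simp [hA, LinearMap.toMatrix_apply]
  refine leviTrace_congr (A := A) ?_ ?_ ?_
  · rw [hA, LinearMap.det_toMatrix, ← LinearMap.isUnit_iff_isUnit_det]
    set S := tangentCoordChange 𝓘(ℂ, E) x₀ x x
    refine IsUnit.of_mul_eq_one S.toLinearMap ?_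
    ext v
    change T (S v) = v
    rw [hT]
    erw [tangentCoordChange_comp (by simpa using hx), tangentCoordChange_self (by simpa using hx)]
  · ext i j
    simp only [frameMatrix, Matrix.of_apply, Matrix.mul_apply, Matrix.transpose_apply,
      Matrix.map_apply]
    rw [tangent_localFrame_eq hx hxx (b i), tangent_localFrame_eq hx hxx (b j), ← hT, hTb, hTb,
      tangent_localFrame_sum hx, tangent_localFrame_sum hx]
    rw [g.form_sum, Finset.sum_comm]
    simp only [Finset.sum_mul]
    refine Finset.sum_congr rfl fun k _ => Finset.sum_congr rfl fun l _ => ?_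
    ring
  · ext i j
    simp only [Matrix.of_apply, Matrix.mul_apply, Matrix.transpose_apply, Matrix.map_apply]
    rw [hlevi, hTb, hTb, leviForm_sum_left]
    simp only [leviForm_sum_right, leviForm_smul_left, leviForm_smul_right, Finset.sum_mul]
    rw [Finset.sum_comm]
    refine Finset.sum_congr rfl fun k _ => Finset.sum_congr rfl fun l _ => ?_
    ring

end Laplacian

/-! ### Calculus of the Laplacian on functions -/

section LaplacianCalculus

variable {E : Type*} [NormedAddCommGroup E] [NormedSpace ℂ E] [FiniteDimensional ℂ E]
  {X : Type*} [TopologicalSpace X] [ChartedSpace E X] [IsManifold 𝓘(ℂ, E) ω X]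
  (g : HermitianMetric E E (fun x : X => TangentSpace 𝓘(ℂ, E) x))

theorem ContMDiffAt.contDiffAt_chart_two {φ : X → ℝ} {x₀ x : X} (hx : x ∈ (chartAt E x₀).source)
    (hφ : ContMDiffAt 𝓘(ℝ, E) 𝓘(ℝ, ℝ) ∞ φ x) :
    ContDiffAt ℝ 2 (fun p => φ ((chartAt E x₀).symm p)) (chartAt E x₀ x) :=
  ((contMDiffAt_iff_contDiffAt_chart hx).1 hφ).of_le two_le_infty

theorem Filter.EventuallyEq.comp_chart_symm {φ ψ : X → ℝ} {x₀ x : X}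
    (hx : x ∈ (chartAt E x₀).source) (h : φ =ᶠ[𝓝 x] ψ) :
    (fun p => φ ((chartAt E x₀).symm p)) =ᶠ[𝓝 (chartAt E x₀ x)]
      fun p => ψ ((chartAt E x₀).symm p) := by
  have h1 : Tendsto (chartAt E x₀).symm (𝓝 (chartAt E x₀ x)) (𝓝 x) := by
    have := ((chartAt E x₀).continuousAt_symm ((chartAt E x₀).map_source hx)).tendsto
    rwa [(chartAt E x₀).left_inv hx] at this
  exact h1.eventually h

theorem hermitianLaplacian_congr {φ ψ : X → ℝ} {x : X}
    (hφ : ContMDiffAt 𝓘(ℝ, E) 𝓘(ℝ, ℝ) ∞ φ x) (h : φ =ᶠ[𝓝 x] ψ) :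
    hermitianLaplacian g φ x = hermitianLaplacian g ψ x := by
  have hx := mem_chart_source E x
  rw [hermitianLaplacian_eq_leviTrace g hx hφ,
    hermitianLaplacian_eq_leviTrace g hx (hφ.congr_of_eventuallyEq h.symm),
    hess_congr (h.comp_chart_symm hx)]

theorem hermitianLaplacian_add {φ ψ : X → ℝ} {x : X}
    (hφ : ContMDiffAt 𝓘(ℝ, E) 𝓘(ℝ, ℝ) ∞ φ x) (hψ : ContMDiffAt 𝓘(ℝ, E) 𝓘(ℝ, ℝ) ∞ ψ x) :
    hermitianLaplacian g (fun y => φ y + ψ y) x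
      = hermitianLaplacian g φ x + hermitianLaplacian g ψ x := by
  have hx := mem_chart_source E x
  rw [hermitianLaplacian_eq_leviTrace g hx hφ, hermitianLaplacian_eq_leviTrace g hx hψ,
    hermitianLaplacian_eq_leviTrace g (φ := fun y => φ y + ψ y) hx (hφ.add hψ),
    hess_add (hφ.contDiffAt_chart_two hx) (hψ.contDiffAt_chart_two hx), leviTrace_add]

theorem hermitianLaplacian_const_mul {φ : X → ℝ} {x : X} (c : ℝ)
    (hφ : ContMDiffAt 𝓘(ℝ, E) 𝓘(ℝ, ℝ) ∞ φ x) :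
    hermitianLaplacian g (fun y => c * φ y) x = c * hermitianLaplacian g φ x := by
  have hx := mem_chart_source E x
  rw [hermitianLaplacian_eq_leviTrace g hx hφ,
    hermitianLaplacian_eq_leviTrace g (φ := fun y => c * φ y) hx (contMDiffAt_const.mul hφ),
    hess_const_mul c (hφ.contDiffAt_chart_two hx), leviTrace_smul]

theorem hermitianLaplacian_const (c : ℝ) (x : X) :
    hermitianLaplacian g (fun _ => c) x = 0 := by
  rw [hermitianLaplacian_eq_leviTrace g (φ := fun _ : X => c) (mem_chart_source E x)
    contMDiffAt_const]
  refine leviTrace_eq_zero _ _ fun v w => ?_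
  have : hess (fun _ : E => c) (chartAt E x x) = 0 := by
    rw [hess, fderiv_fun_const]
    exact fderiv_const_apply 0
  rw [this]; simp [leviForm]

/-- The chart is left free so that the gradient term can be computed in one fixed chart over a whole
coordinate ball, as the barrier construction requires. -/
theorem hermitianLaplacian_comp {χ : ℝ → ℝ} {φ : X → ℝ} {x₀ x : X}
    (hx : x ∈ (chartAt E x₀).source) (hχ : ContDiff ℝ ∞ χ)
    (hφ : ContMDiffAt 𝓘(ℝ, E) 𝓘(ℝ, ℝ) ∞ φ x) :
    hermitianLaplacian g (fun y => χ (φ y)) x = deriv (deriv χ) (φ x) *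
        leviTrace (frameMatrix g x₀ x)
          ((fderiv ℝ (fun p => φ ((chartAt E x₀).symm p)) (chartAt E x₀ x)).smulRight
            (fderiv ℝ (fun p => φ ((chartAt E x₀).symm p)) (chartAt E x₀ x)))
      + deriv χ (φ x) * hermitianLaplacian g φ x := by
  have h1 : ContMDiffAt 𝓘(ℝ, E) 𝓘(ℝ, ℝ) ∞ (fun y => χ (φ y)) x :=
    hχ.contDiffAt.contMDiffAt.comp x hφ
  rw [hermitianLaplacian_eq_leviTrace g hx hφ, hermitianLaplacian_eq_leviTrace g hx h1,
    hess_real_comp (φ := fun p => φ ((chartAt E x₀).symm p))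
      (hχ.contDiffAt.of_le two_le_infty) (hφ.contDiffAt_chart_two hx),
    leviTrace_add, leviTrace_smul, leviTrace_smul, (chartAt E x₀).left_inv hx]

/-- The gradient term is nonnegative by ellipticity. This is the estimate behind both uses of
`smoothRamp`, in the barrier and in the final weight. -/
theorem le_hermitianLaplacian_comp {χ : ℝ → ℝ} {φ : X → ℝ} {x : X} (hχ : ContDiff ℝ ∞ χ)
    (hφ : ContMDiffAt 𝓘(ℝ, E) 𝓘(ℝ, ℝ) ∞ φ x) (h2 : 0 ≤ deriv (deriv χ) (φ x)) :
    deriv χ (φ x) * hermitianLaplacian g φ x ≤ hermitianLaplacian g (fun y => χ (φ y)) x := by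
  have hx := mem_chart_source E x
  rw [hermitianLaplacian_comp g hx hχ hφ]
  have := mul_nonneg h2 (leviTrace_smulRight_nonneg (frameMatrix_posDef g hx)
    (fderiv ℝ (fun p => φ ((chartAt E x).symm p)) (chartAt E x x)))
  linarith

/-- By definition the chart changes with the point. In the fixed chart at `x` the Laplacian becomes
a contraction of continuously varying matrices and Hessians. -/
theorem continuousAt_hermitianLaplacian {φ : X → ℝ} {x : X}
    (hφ : ContMDiffAt 𝓘(ℝ, E) 𝓘(ℝ, ℝ) ∞ φ x) (hev : ∀ᶠ y in 𝓝 x, ContMDiffAt 𝓘(ℝ, E) 𝓘(ℝ, ℝ) ∞ φ y) :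
    ContinuousAt (hermitianLaplacian g φ) x := by
  have hx := mem_chart_source E x
  have hs := (chartAt E x).open_source.mem_nhds hx
  have h : (fun y => leviTrace (frameMatrix g x y)
      (hess (fun p => φ ((chartAt E x).symm p)) (chartAt E x y))) =ᶠ[𝓝 x]
      hermitianLaplacian g φ := by
    filter_upwards [hev, hs] with y hy hys
    rw [hermitianLaplacian_eq_leviTrace g hys hy]
  refine ContinuousAt.congr ?_ h
  refine continuousAt_leviTrace ((continuousOn_frameMatrix g x).continuousAt hs)
    ((Matrix.isUnit_iff_isUnit_det _).1 (frameMatrix_posDef g hx).isUnit).ne_zero ?_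
  have h2 : ContDiffAt ℝ 2 (fun p => φ ((chartAt E x).symm p)) (chartAt E x x) :=
    hφ.contDiffAt_chart_two hx
  have h3 : ContinuousAt (hess fun p => φ ((chartAt E x).symm p)) (chartAt E x x) :=
    ((h2.fderiv_right (m := 1) (by norm_num)).fderiv_right (m := 0) (by norm_num)).continuousAt
  exact h3.comp ((chartAt E x).continuousAt hx)

theorem continuousOn_hermitianLaplacian {φ : X → ℝ} {U : Set X} (hU : IsOpen U)
    (hφ : ContMDiffOn 𝓘(ℝ, E) 𝓘(ℝ, ℝ) ∞ φ U) :
    ContinuousOn (hermitianLaplacian g φ) U := fun x hx =>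
  (continuousAt_hermitianLaplacian g (hφ.contMDiffAt (hU.mem_nhds hx))
    (by filter_upwards [hU.mem_nhds hx] with y hy using hφ.contMDiffAt (hU.mem_nhds hy))).continuousWithinAt

theorem continuous_hermitianLaplacian {φ : X → ℝ} (hφ : ContMDiff 𝓘(ℝ, E) 𝓘(ℝ, ℝ) ∞ φ) :
    Continuous (hermitianLaplacian g φ) :=
  continuous_iff_continuousAt.2 fun x =>
    continuousAt_hermitianLaplacian g (hφ x) (Eventually.of_forall hφ)

theorem contDiff_complex_normSq : ContDiff ℝ ∞ fun z : ℂ => Complex.normSq z := by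
  simp only [Complex.normSq_apply]
  exact (Complex.reCLM.contDiff.mul Complex.reCLM.contDiff).add
    (Complex.imCLM.contDiff.mul Complex.imCLM.contDiff)

theorem contMDiffAt_log_normSq {f : X → ℂ} {x : X} (hf : ContMDiffAt 𝓘(ℂ, E) 𝓘(ℂ, ℂ) ω f x)
    (h0 : f x ≠ 0) :
    ContMDiffAt 𝓘(ℝ, E) 𝓘(ℝ, ℝ) ∞ (fun y => Real.log (Complex.normSq (f y))) x := by
  have h1 : ContDiffAt ℝ ∞ (fun z : ℂ => Real.log (Complex.normSq z)) (f x) := by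
    exact contDiff_complex_normSq.contDiffAt.log (by simpa using h0)
  exact h1.contMDiffAt.comp x hf.real_of_holomorphic

theorem hermitianLaplacian_log_normSq {f : X → ℂ} {x : X}
    (hf : ContMDiffAt 𝓘(ℂ, E) 𝓘(ℂ, ℂ) ω f x) (h0 : f x ≠ 0) :
    hermitianLaplacian g (fun y => Real.log (Complex.normSq (f y))) x = 0 := by
  have hx := mem_chart_source E x
  rw [hermitianLaplacian_eq_leviTrace g hx (contMDiffAt_log_normSq hf h0)]
  refine leviTrace_eq_zero _ _ fun v w => ?_
  exact leviForm_hess_log_normSq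
    ((contDiffAt_chart_of_holomorphic hx hf).of_le le_top) (by simpa using h0) v w

end LaplacianCalculus

/-! ### A smooth convex cutoff -/

section SmoothRamp

/-- A smooth convex function on the line that vanishes for `t ≤ 0` and has slope `1` for `t ≥ 1`. -/
def smoothRamp (t : ℝ) : ℝ := ∫ s in (0 : ℝ)..t, Real.smoothTransition s

theorem deriv_smoothRamp : deriv smoothRamp = Real.smoothTransition := by
  ext t
  exact Real.smoothTransition.continuous.deriv_integral _ 0 t

theorem contDiff_smoothRamp : ContDiff ℝ ∞ smoothRamp := by
  refine contDiff_infty_iff_deriv.2 ⟨fun t => ?_, ?_⟩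
  · exact ((Real.smoothTransition.continuous.integral_hasStrictDerivAt 0 t).hasDerivAt).differentiableAt
  · rw [deriv_smoothRamp]; exact Real.smoothTransition.contDiff (n := ⊤)

theorem smoothRamp_of_nonpos {t : ℝ} (ht : t ≤ 0) : smoothRamp t = 0 := by
  rw [smoothRamp, intervalIntegral.integral_symm]
  rw [intervalIntegral.integral_congr (g := fun _ => 0)]
  · simp
  · intro s hs
    rw [uIcc_of_le ht] at hs
    exact Real.smoothTransition.zero_of_nonpos hs.2

theorem deriv_deriv_smoothRamp_nonneg (t : ℝ) : 0 ≤ deriv (deriv smoothRamp) t := by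
  rw [deriv_smoothRamp]
  exact Real.smoothTransition.monotone.deriv_nonneg

end SmoothRamp

/-! ### Hopf barriers and the pushing lemma -/

section Pushing

variable {E : Type*} [NormedAddCommGroup E] [NormedSpace ℂ E] [FiniteDimensional ℂ E]
  {X : Type*} [TopologicalSpace X] [T2Space X] [ChartedSpace E X] [IsManifold 𝓘(ℂ, E) ω X]
  (g : HermitianMetric E E (fun x : X => TangentSpace 𝓘(ℂ, E) x))

theorem contDiff_euclidean_dist_sq (c : E) : ContDiff ℝ ∞ fun z => Euclidean.dist z c ^ 2 := by
  have h : ContDiff ℝ ∞ fun z => ‖toEuclidean z - toEuclidean c‖ ^ 2 :=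
    (toEuclidean.contDiff.sub contDiff_const).norm_sq ℝ
  simpa only [Euclidean.dist, dist_eq_norm] using h

theorem fderiv_euclidean_dist_sq_ne_zero {c z : E} (h : z ≠ c) :
    fderiv ℝ (fun z => Euclidean.dist z c ^ 2) z ≠ 0 := by
  have h1 : HasFDerivAt (fun z : E => toEuclidean z - toEuclidean c)
      (toEuclidean (E := E) : E →L[ℝ] _) z := by
    simpa using (toEuclidean (E := E)).hasFDerivAt.sub_const (toEuclidean c)
  have h2 := h1.norm_sq
  have e : (fun z => Euclidean.dist z c ^ 2) = fun z => ‖toEuclidean z - toEuclidean c‖ ^ 2 := by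
    ext; simp only [Euclidean.dist, dist_eq_norm]
  rw [e, h2.fderiv]
  intro h3
  have h4 := congrArg (fun L => L (z - c)) h3
  rw [← map_sub] at h4
  simp only [smul_apply, ContinuousLinearMap.comp_apply, coe_innerSL_apply,
    ContinuousLinearEquiv.coe_coe, zero_apply, real_inner_self_eq_norm_sq] at h4
  simp [sub_eq_zero] at h4
  exact h h4

theorem continuous_smulRight_self :
    Continuous fun ξ : E →L[ℝ] ℝ => ξ.smulRight ξ := by
  have h : (fun ξ : E →L[ℝ] ℝ => ξ.smulRight ξ)
      = fun ξ => ContinuousLinearMap.smulRightL ℝ E (E →L[ℝ] ℝ) ξ ξ := by ext; simp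
  rw [h]
  exact (ContinuousLinearMap.smulRightL ℝ E (E →L[ℝ] ℝ)).continuous.clm_apply continuous_id

/-- In a coordinate ball there is a smooth function, supported in the ball, whose Laplacian is
nonnegative outside an arbitrarily small concentric ball and positive in between. -/
theorem exists_annular_bump (x₀ : X) (c : E) {r R : ℝ} (hr : 0 < r) (hR : 0 ≤ R)
    (hsub : Euclidean.closedBall c R ⊆ (chartAt E x₀).target) :
    ∃ b : X → ℝ, ContMDiff 𝓘(ℝ, E) 𝓘(ℝ, ℝ) ∞ b ∧
      tsupport b ⊆ (chartAt E x₀).symm '' Euclidean.closedBall c R ∧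
      (∀ y, y ∉ (chartAt E x₀).symm '' Euclidean.ball c r → 0 ≤ hermitianLaplacian g b y) ∧
      ∀ y ∈ (chartAt E x₀).source, r ≤ Euclidean.dist (chartAt E x₀ y) c →
        Euclidean.dist (chartAt E x₀ y) c < R → 0 < hermitianLaplacian g b y := by
  set ch := chartAt E x₀ with hch
  set q : E → ℝ := fun z => Euclidean.dist z c ^ 2 with hq
  set S := ch.symm '' Euclidean.closedBall c R with hS
  have hSsrc : S ⊆ ch.source := by
    rintro _ ⟨z, hz, rfl⟩; exact ch.map_target (hsub hz)
  have hScomp : IsCompact S := Euclidean.isCompact_closedBall.image_of_continuousOn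
    (ch.continuousOn_symm.mono hsub)
  have hSmem : ∀ y ∈ ch.source, (y ∈ S ↔ Euclidean.dist (ch y) c ≤ R) := by
    intro y hy
    constructor
    · rintro ⟨z, hz, rfl⟩
      rw [ch.right_inv (hsub hz)]; exact hz
    · intro h; exact ⟨ch y, h, ch.left_inv hy⟩
  set w₀ : X → ℝ := fun y => q (ch y) with hw₀
  have hw₀s : ∀ y ∈ ch.source, ContMDiffAt 𝓘(ℝ, E) 𝓘(ℝ, ℝ) ∞ w₀ y := by
    intro y hy
    refine (contMDiffAt_iff_contDiffAt_chart hy).2 ?_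
    refine (contDiff_euclidean_dist_sq c).contDiffAt.congr_of_eventuallyEq ?_
    filter_upwards [ch.open_target.mem_nhds (ch.map_source hy)] with z hz
    simp only [hw₀]; rw [ch.right_inv hz]
  have hfd : ∀ y ∈ ch.source, fderiv ℝ (fun p => w₀ (ch.symm p)) (ch y) = fderiv ℝ q (ch y) := by
    intro y hy
    refine Filter.EventuallyEq.fderiv_eq ?_
    filter_upwards [ch.open_target.mem_nhds (ch.map_source hy)] with z hz
    simp only [hw₀]; rw [ch.right_inv hz]
  -- `a` is the squared gradient of `q`, the coefficient of `χ''` in the Laplacian of `χ ∘ q`. It is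
  -- positive on the compact annulus `A`, where `q` has no critical point.
  set a : X → ℝ := fun y => leviTrace (frameMatrix g x₀ y)
    ((fderiv ℝ q (ch y)).smulRight (fderiv ℝ q (ch y))) with ha
  have hacont : ContinuousOn a ch.source := by
    intro y hy
    refine ContinuousAt.continuousWithinAt ?_
    refine continuousAt_leviTrace ((continuousOn_frameMatrix g x₀).continuousAt
      (ch.open_source.mem_nhds hy))
      ((Matrix.isUnit_iff_isUnit_det _).1 (frameMatrix_posDef g hy).isUnit).ne_zero ?_
    have h1 : Continuous (fderiv ℝ q) :=
      (contDiff_euclidean_dist_sq c).continuous_fderiv (by simp)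
    exact (continuous_smulRight_self.comp h1).continuousAt.comp (ch.continuousAt hy)
  set A := S ∩ {y | y ∈ ch.source ∧ r ≤ Euclidean.dist (ch y) c} with hA
  have hAcomp : IsCompact A := by
    have : A = ch.symm '' (Euclidean.closedBall c R ∩ {z | r ≤ Euclidean.dist z c}) := by
      ext y
      constructor
      · rintro ⟨⟨z, hz, rfl⟩, -, h2⟩
        rw [ch.right_inv (hsub hz)] at h2
        exact ⟨z, ⟨hz, h2⟩, rfl⟩
      · rintro ⟨z, ⟨hz, h2⟩, rfl⟩
        refine ⟨⟨z, hz, rfl⟩, ch.map_target (hsub hz), ?_⟩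
        rwa [ch.right_inv (hsub hz)]
    rw [this]
    refine (Euclidean.isCompact_closedBall.inter_right ?_).image_of_continuousOn
      (ch.continuousOn_symm.mono (inter_subset_left.trans hsub))
    refine isClosed_le continuous_const ?_
    exact toEuclidean.continuous.dist continuous_const
  have hapos : ∀ y ∈ A, 0 < a y := by
    rintro y ⟨-, hy, hry⟩
    refine leviTrace_smulRight_pos (frameMatrix_posDef g hy) (fderiv_euclidean_dist_sq_ne_zero ?_)
    rintro h
    rw [h] at hry
    simp [Euclidean.dist] at hry
    linarith
  have hlcont : ContinuousOn (hermitianLaplacian g w₀) ch.source :=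
    continuousOn_hermitianLaplacian g ch.open_source fun y hy => (hw₀s y hy).contMDiffWithinAt
  obtain ⟨M, hM⟩ := hAcomp.exists_bound_of_continuousOn (f := fun y => hermitianLaplacian g w₀ y / a y)
    ((hlcont.mono fun y hy => hy.2.1).div (hacont.mono fun y hy => hy.2.1)
      fun y hy => (hapos y hy).ne')
  -- With this `l` the term `l² a` coming from `χ''` strictly dominates `l Δq` throughout the
  -- annulus.
  set l : ℝ := |M| + 1 with hl
  have hl0 : 0 < l := by positivity
  have hlA : ∀ y ∈ A, hermitianLaplacian g w₀ y < l * a y := by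
    intro y hy
    rw [← div_lt_iff₀ (hapos y hy)]
    have h1 := hM y hy
    have h2 := le_abs_self (hermitianLaplacian g w₀ y / a y)
    have h3 := le_abs_self M
    rw [Real.norm_eq_abs] at h1
    linarith
  -- Hopf's barrier, normalized to be positive inside the ball of radius `R` and nonpositive
  -- outside. Composing with `smoothRamp` then extends it smoothly by zero without spoiling the sign
  -- of the Laplacian on the annulus.
  set χ : ℝ → ℝ := fun t => Real.exp (-l * t) - Real.exp (-l * R ^ 2) with hχ
  have hχs : ContDiff ℝ ∞ χ := by rw [hχ]; fun_prop
  have hd1 : deriv χ = fun t => -l * Real.exp (-l * t) := by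
    ext t
    have h : HasDerivAt χ (Real.exp (-l * t) * (-l * 1)) t :=
      (((hasDerivAt_id t).const_mul (-l)).exp).sub_const _
    rw [h.deriv]; ring
  have hd2 : deriv (deriv χ) = fun t => l ^ 2 * Real.exp (-l * t) := by
    rw [hd1]
    ext t
    have h : HasDerivAt (fun t => -l * Real.exp (-l * t)) (-l * (Real.exp (-l * t) * (-l * 1))) t :=
      (((hasDerivAt_id t).const_mul (-l)).exp).const_mul _
    rw [h.deriv]; ring
  have hws : ∀ y ∈ ch.source, ContMDiffAt 𝓘(ℝ, E) 𝓘(ℝ, ℝ) ∞ (fun y => χ (w₀ y)) y :=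
    fun y hy => hχs.contDiffAt.contMDiffAt.comp y (hw₀s y hy)
  have hwpos : ∀ y ∈ A, 0 < hermitianLaplacian g (fun y => χ (w₀ y)) y := by
    intro y hy
    rw [hermitianLaplacian_comp g hy.2.1 hχs (hw₀s y hy.2.1), ← hch, hfd y hy.2.1, hd2, hd1]
    change 0 < l ^ 2 * Real.exp (-l * w₀ y) * a y + -l * Real.exp (-l * w₀ y) * _
    have : 0 < l * Real.exp (-l * w₀ y) * (l * a y - hermitianLaplacian g w₀ y) :=
      mul_pos (by positivity) (sub_pos.2 (hlA y hy))
    linarith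
  classical
  set b : X → ℝ := fun y => if y ∈ ch.source then smoothRamp (χ (w₀ y)) else 0 with hb
  have hb0 : ∀ y, y ∉ S → b y = 0 := by
    intro y hy
    by_cases hys : y ∈ ch.source
    · simp only [hb, if_pos hys]
      refine smoothRamp_of_nonpos ?_
      rw [hSmem y hys, not_le] at hy
      simp only [hχ, sub_nonpos, Real.exp_le_exp, hw₀, hq]
      nlinarith [mul_le_mul_of_nonneg_left (pow_le_pow_left₀ hR hy.le 2) hl0.le]
    · simp only [hb, if_neg hys]
  have hbs : ∀ y ∈ ch.source, b =ᶠ[𝓝 y] fun y => smoothRamp (χ (w₀ y)) := by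
    intro y hy
    filter_upwards [ch.open_source.mem_nhds hy] with z hz
    simp only [hb, if_pos hz]
  have hbz : ∀ y, y ∉ S → b =ᶠ[𝓝 y] fun _ => 0 := by
    intro y hy
    filter_upwards [hScomp.isClosed.isOpen_compl.mem_nhds hy] with z hz using hb0 z hz
  have hbsm : ContMDiff 𝓘(ℝ, E) 𝓘(ℝ, ℝ) ∞ b := by
    intro y
    by_cases hy : y ∈ S
    · have h1 : ContMDiffAt 𝓘(ℝ, E) 𝓘(ℝ, ℝ) ∞ (fun y => smoothRamp (χ (w₀ y))) y :=
        contDiff_smoothRamp.contDiffAt.contMDiffAt.comp y (hws y (hSsrc hy))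
      exact h1.congr_of_eventuallyEq (hbs y (hSsrc hy))
    · exact contMDiffAt_const.congr_of_eventuallyEq (hbz y hy)
  have hble : ∀ y ∈ ch.source, Real.smoothTransition (χ (w₀ y)) *
      hermitianLaplacian g (fun y => χ (w₀ y)) y ≤ hermitianLaplacian g b y := by
    intro y hy
    rw [hermitianLaplacian_congr g (hbsm y) (hbs y hy), ← deriv_smoothRamp]
    exact le_hermitianLaplacian_comp g contDiff_smoothRamp (hws y hy)
      (deriv_deriv_smoothRamp_nonneg _)
  refine ⟨b, hbsm, ?_, ?_, ?_⟩
  · refine closure_minimal ?_ hScomp.isClosed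
    intro y hy
    by_contra h
    exact hy (hb0 y h)
  · intro y hy
    by_cases hyS : y ∈ S
    · have hys := hSsrc hyS
      refine le_trans ?_ (hble y hys)
      refine mul_nonneg (Real.smoothTransition.nonneg _) (hwpos y ⟨hyS, hys, ?_⟩).le
      by_contra h
      exact hy ⟨ch y, not_le.1 h, ch.left_inv hys⟩
    · rw [hermitianLaplacian_congr g (hbsm y) (hbz y hyS), hermitianLaplacian_const]
  · intro y hys h1 h2
    refine lt_of_lt_of_le ?_ (hble y hys)
    refine mul_pos (Real.smoothTransition.pos_of_pos ?_)
      (hwpos y ⟨(hSmem y hys).2 h2.le, hys, h1⟩)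
    simp only [hχ, sub_pos, Real.exp_lt_exp, hw₀, hq]
    have := pow_lt_pow_left₀ h2 (hr.le.trans h1) two_ne_zero
    nlinarith [mul_lt_mul_of_pos_left this hl0]

/-- In an open connected set `C` the nonpositivity of the Laplacian can be pushed into any open set `N`
that meets `C`. -/
theorem exists_pushing {C N : Set X} (hC : IsOpen C) (hCc : IsPreconnected C) (hN : IsOpen N)
    (hne : (C ∩ N).Nonempty) {x : X} (hx : x ∈ C) (hxN : x ∉ N) :
    ∃ v : X → ℝ, ContMDiff 𝓘(ℝ, E) 𝓘(ℝ, ℝ) ∞ v ∧ tsupport v ⊆ C ∧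
      (∀ y, y ∉ N → 0 ≤ hermitianLaplacian g v y) ∧ 0 < hermitianLaplacian g v x := by
  set P : (X → ℝ) → Prop := fun v => ContMDiff 𝓘(ℝ, E) 𝓘(ℝ, ℝ) ∞ v ∧ tsupport v ⊆ C ∧
      ∀ y, y ∉ N → 0 ≤ hermitianLaplacian g v y with hP
  -- `T` consists of the points where positivity is attainable, together with `C ∩ N`. It is open
  -- and meets `C`; the main work is to show that it is relatively closed in `C`, by carrying
  -- positivity from a nearby `c ∈ T` to a limit point `y`.
  set T : Set X := {y | y ∈ C ∧ (y ∈ N ∨ ∃ v, P v ∧ 0 < hermitianLaplacian g v y)} with hT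
  suffices h : C ⊆ T by
    obtain ⟨-, h1 | ⟨v, hv, h2⟩⟩ := h hx
    · exact absurd h1 hxN
    · exact ⟨v, hv.1, hv.2.1, hv.2.2, h2⟩
  have hTo : IsOpen T := by
    rw [isOpen_iff_mem_nhds]
    rintro y ⟨hyC, h1 | ⟨v, hv, h2⟩⟩
    · filter_upwards [hC.mem_nhds hyC, hN.mem_nhds h1] with z hz hz' using ⟨hz, Or.inl hz'⟩
    · filter_upwards [hC.mem_nhds hyC,
        (isOpen_lt continuous_const (continuous_hermitianLaplacian g hv.1)).mem_nhds h2]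
        with z hz hz' using ⟨hz, Or.inr ⟨v, hv, hz'⟩⟩
  refine hCc.subset_of_closure_inter_subset hTo ?_ ?_
  · obtain ⟨y, hy, hyN⟩ := hne
    exact ⟨y, hy, hy, Or.inl hyN⟩
  rintro y ⟨hyT, hyC⟩
  by_cases hyN : y ∈ N
  · exact ⟨hyC, Or.inl hyN⟩
  set ch := chartAt E y with hch
  have hys : y ∈ ch.source := mem_chart_source E y
  have hD : IsOpen (ch.target ∩ ch.symm ⁻¹' C) := ch.isOpen_inter_preimage_symm hC
  obtain ⟨ρ, hρ, hρD⟩ := Euclidean.nhds_basis_closedBall.mem_iff.1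
    (hD.mem_nhds ⟨ch.map_source hys, by simpa [ch.left_inv hys] using hyC⟩)
  have hnb : ch.source ∩ ch ⁻¹' Euclidean.ball (ch y) (ρ / 2) ∈ 𝓝 y :=
    inter_mem (ch.open_source.mem_nhds hys)
      ((ch.continuousAt hys).preimage_mem_nhds (Euclidean.ball_mem_nhds (by linarith)))
  obtain ⟨c, ⟨hcs, hcb⟩, hcT⟩ := mem_closure_iff_nhds.1 hyT _ hnb
  by_cases hcy : c = y
  · exact hcy ▸ hcT
  set d := Euclidean.dist (ch y) (ch c) with hd
  have hd' : d = Euclidean.dist (ch c) (ch y) := by simp only [hd, Euclidean.dist, dist_comm]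
  have hd0 : 0 < d := by
    refine dist_pos.2 fun h => hcy ?_
    exact (ch.injOn hys hcs (toEuclidean.injective h)).symm
  have hdρ : d < ρ / 2 := by rw [hd']; exact hcb
  -- The barrier is centred at `c`, not at `y`. Since `d < ρ / 2`, the ball of radius `ρ / 2` about
  -- `c` contains `y` in its interior and stays inside the ball of radius `ρ` about `y`.
  have hball : Euclidean.closedBall (ch c) (ρ / 2) ⊆ ch.target ∩ ch.symm ⁻¹' C := by
    refine fun z hz => hρD ?_
    have h1 : Euclidean.dist z (ch c) ≤ ρ / 2 := hz
    have h2 : Euclidean.dist z (ch y) ≤ Euclidean.dist z (ch c) + Euclidean.dist (ch c) (ch y) :=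
      dist_triangle _ _ _
    change Euclidean.dist z (ch y) ≤ ρ
    linarith
  have hsub : Euclidean.closedBall (ch c) (ρ / 2) ⊆ ch.target := hball.trans inter_subset_left
  have himC : ch.symm '' Euclidean.closedBall (ch c) (ρ / 2) ⊆ C := by
    rintro _ ⟨z, hz, rfl⟩; exact (hball hz).2
  have hbump : ∀ W ∈ 𝓝 c, ∃ b : X → ℝ, ContMDiff 𝓘(ℝ, E) 𝓘(ℝ, ℝ) ∞ b ∧ tsupport b ⊆ C ∧
      (∃ K, IsCompact K ∧ K ⊆ W ∧ ∀ z, z ∉ K → 0 ≤ hermitianLaplacian g b z) ∧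
      0 < hermitianLaplacian g b y := by
    intro W hW
    have hW' : ch.symm ⁻¹' W ∈ 𝓝 (ch c) := by
      refine (ch.continuousAt_symm (ch.map_source hcs)).preimage_mem_nhds ?_
      rwa [ch.left_inv hcs]
    obtain ⟨r, hr, hrW⟩ := Euclidean.nhds_basis_closedBall.mem_iff.1 hW'
    -- The inner radius is at most `r`, to keep the bad set inside `W`, and at most `d`, to put `y`
    -- in the annulus where the Laplacian is positive.
    obtain ⟨b, hb1, hb2, hb3, hb4⟩ := exists_annular_bump g y (ch c) (r := min r d) (R := ρ / 2)
      (lt_min hr hd0) (by linarith) hsub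
    refine ⟨b, hb1, hb2.trans himC, ?_, hb4 y hys (min_le_right _ _) hdρ⟩
    refine ⟨ch.symm '' Euclidean.closedBall (ch c) (min r d), ?_, ?_, ?_⟩
    · refine Euclidean.isCompact_closedBall.image_of_continuousOn (ch.continuousOn_symm.mono ?_)
      refine fun z hz => hsub ?_
      have : Euclidean.dist z (ch c) ≤ min r d := hz
      have h2 := min_le_right r d
      change Euclidean.dist z (ch c) ≤ ρ / 2
      linarith
    · rintro _ ⟨z, hz, rfl⟩
      exact hrW (show Euclidean.dist z (ch c) ≤ r from le_trans hz (min_le_left _ _))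
    · exact fun z hz => hb3 z fun h => hz (image_mono Euclidean.ball_subset_closedBall h)
  obtain ⟨hcC, hcN | ⟨v, ⟨hv1, hv2, hv3⟩, hv4⟩⟩ := hcT
  · obtain ⟨b, hb1, hb2, ⟨K, -, hKW, hK⟩, hb4⟩ := hbump N (hN.mem_nhds hcN)
    exact ⟨hyC, Or.inr ⟨b, ⟨hb1, hb2, fun z hz => hK z fun h => hz (hKW h)⟩, hb4⟩⟩
  · set m := hermitianLaplacian g v c / 2 with hm
    have hm0 : 0 < m := by positivity
    obtain ⟨b, hb1, hb2, ⟨K, hKc, hKW, hK⟩, hb4⟩ := hbump {z | m < hermitianLaplacian g v z}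
      ((isOpen_lt continuous_const (continuous_hermitianLaplacian g hv1)).mem_nhds
        (show m < hermitianLaplacian g v c by linarith))
    obtain ⟨M, hM⟩ := hKc.exists_bound_of_continuousOn (continuous_hermitianLaplacian g hb1).continuousOn
    -- On `K` the Laplacian of `v` exceeds `m` and that of `b` is at least `-|M|`, so the multiple
    -- `l` of `v` absorbs the negative part of `b`.
    set l := |M| / m with hl
    have hl0 : 0 ≤ l := by positivity
    have hlap : ∀ z, hermitianLaplacian g (fun z => l * v z + b z) z
        = l * hermitianLaplacian g v z + hermitianLaplacian g b z := fun z => by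
      rw [hermitianLaplacian_add g (φ := fun z => l * v z) (contMDiffAt_const.mul (hv1 z)) (hb1 z),
        hermitianLaplacian_const_mul g l (hv1 z)]
    refine ⟨hyC, Or.inr ⟨fun z => l * v z + b z, ⟨(contMDiff_const.mul hv1).add hb1, ?_, ?_⟩, ?_⟩⟩
    · refine (closure_mono (t := Function.support v ∪ Function.support b) ?_).trans ?_
      · intro z hz
        by_contra h
        simp only [mem_union, Function.mem_support, not_or, not_not] at h
        exact hz (by simp [h.1, h.2])
      · rw [closure_union]
        exact union_subset hv2 hb2
    · intro z hz
      rw [hlap]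
      by_cases hzK : z ∈ K
      · have h1 : m < hermitianLaplacian g v z := hKW hzK
        have h2 := hM z hzK
        rw [Real.norm_eq_abs] at h2
        have h3 := neg_abs_le (hermitianLaplacian g b z)
        have h4 := le_abs_self M
        have h5 : l * m = |M| := by rw [hl]; field_simp
        have h6 := mul_le_mul_of_nonneg_left h1.le hl0
        linarith
      · exact add_nonneg (mul_nonneg hl0 (hv3 z hz)) (hK z hzK)
    · rw [hlap]
      have := mul_nonneg hl0 (hv3 y hyN)
      linarith

end Pushing

/-! ### Exhaustions without trapped complementary components -/

section Exhaustion

theorem connectedComponentIn_compl_empty_not_subset {X : Type*} [TopologicalSpace X]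
    [ConnectedSpace X] [NoncompactSpace X] {L : Set X} (hL : IsCompact L) (x : X) :
    ¬ connectedComponentIn (∅ : Set X)ᶜ x ⊆ L := by
  intro h
  rw [compl_empty, connectedComponentIn_univ, PreconnectedSpace.connectedComponent_eq_univ,
    univ_subset_iff] at h
  exact noncompact_univ X (h ▸ hL)

variable {X : Type*} [TopologicalSpace X] [T2Space X] [LocallyCompactSpace X]
  [LocallyConnectedSpace X] [ConnectedSpace X] [NoncompactSpace X]

/-- Outside a large enough compact set, no point lies in a relatively compact component of the
complement of a given compact set. -/
theorem IsCompact.exists_isCompact_component_not_subset {K : Set X} (hK : IsCompact K) :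
    ∃ K' : Set X, IsCompact K' ∧ ∀ x, x ∉ K' → ∀ L, IsCompact L →
      ¬ connectedComponentIn Kᶜ x ⊆ L := by
  rcases K.eq_empty_or_nonempty with rfl | hne
  · exact ⟨∅, isCompact_empty, fun x _ L hL => connectedComponentIn_compl_empty_not_subset hL x⟩
  obtain ⟨V, hV, hKV⟩ := exists_compact_superset hK
  have hKo : IsOpen Kᶜ := hK.isClosed.isOpen_compl
  have hB : IsCompact (V \ interior V) := hV.diff isOpen_interior
  -- Components of the open set `Kᶜ` are open by local connectedness, so finitely many of them cover
  -- the compact shell `V \ interior V`.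
  obtain ⟨t, -, ht⟩ := hB.elim_nhds_subcover (fun y => connectedComponentIn Kᶜ y) fun y hy =>
    hKo.connectedComponentIn.mem_nhds (mem_connectedComponentIn fun h => hy.2 (hKV h))
  have hL : ∀ y : X, ∃ L, IsCompact L ∧ ((∃ L', IsCompact L' ∧ connectedComponentIn Kᶜ y ⊆ L') →
      connectedComponentIn Kᶜ y ⊆ L) := by
    intro y
    by_cases h : ∃ L', IsCompact L' ∧ connectedComponentIn Kᶜ y ⊆ L'
    · obtain ⟨L', h1, h2⟩ := h
      exact ⟨L', h1, fun _ => h2⟩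
    · exact ⟨∅, isCompact_empty, fun h' => absurd h' h⟩
  choose L hLc hLs using hL
  refine ⟨V ∪ ⋃ y ∈ t, L y, hV.union (t.isCompact_biUnion fun y _ => hLc y), ?_⟩
  intro x hx L₀ hL₀ hsub
  have hxV : x ∉ V := fun h => hx (Or.inl h)
  have hxK : x ∈ Kᶜ := fun h => hxV (interior_subset (hKV h))
  set C := connectedComponentIn Kᶜ x with hC
  have hxC : x ∈ C := mem_connectedComponentIn hxK
  have hCp : IsPreconnected C := isPreconnected_connectedComponentIn
  -- A component that missed `interior V` would be clopen, hence all of `X`, although it avoids the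
  -- nonempty set `K`.
  have hCV : (C ∩ interior V).Nonempty := by
    by_contra h
    rw [not_nonempty_iff_eq_empty, ← disjoint_iff_inter_eq_empty] at h
    have h1 : Disjoint (closure C) (interior V) := h.closure_left isOpen_interior
    have h2 : closure C ⊆ C := hCp.closure.subset_connectedComponentIn (subset_closure hxC)
      fun z hz hzK => h1.notMem_of_mem_left hz (hKV hzK)
    have h3 : IsClopen C := ⟨isClosed_of_closure_subset h2, hKo.connectedComponentIn⟩
    have h4 := h3.eq_univ ⟨x, hxC⟩
    obtain ⟨z, hz⟩ := hne
    exact h.notMem_of_mem_left (h4 ▸ mem_univ z) (hKV hz)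
  -- `C` meets `interior V` and contains `x ∉ V`, so by connectedness it crosses the shell and is
  -- one of the finitely many chosen components.
  have hCB : (C ∩ (V \ interior V)).Nonempty := by
    by_contra h
    rw [not_nonempty_iff_eq_empty] at h
    have h1 := hCp (interior V) Vᶜ isOpen_interior hV.isClosed.isOpen_compl (fun z hz => by
      by_cases hzV : z ∈ V
      · by_contra h2
        have : z ∈ C ∩ (V \ interior V) := ⟨hz, hzV, fun h3 => h2 (Or.inl h3)⟩
        rw [h] at this
        exact this
      · exact Or.inr hzV) hCV ⟨x, hxC, hxV⟩
    obtain ⟨z, -, hz1, hz2⟩ := h1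
    exact hz2 (interior_subset hz1)
  obtain ⟨z, hzC, hzB⟩ := hCB
  obtain ⟨y, hyt, hy⟩ := mem_iUnion₂.1 (ht hzB)
  have e : connectedComponentIn Kᶜ y = C := by
    rw [connectedComponentIn_eq hy, hC, connectedComponentIn_eq hzC]
  refine hx (Or.inr (mem_iUnion₂.2 ⟨y, hyt, ?_⟩))
  exact hLs y ⟨L₀, hL₀, e ▸ hsub⟩ (e ▸ hxC)

/-- Each stage has in its interior the previous stage, one set of `compactCovering`, and the compact
set that `IsCompact.exists_isCompact_component_not_subset` attaches to the previous stage. The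
recursion starts from `∅`. -/
theorem exists_exhaustion_component_not_subset [SigmaCompactSpace X] :
    ∃ K : ℕ → Set X, (∀ n, IsCompact (K n)) ∧ (∀ n, K n ⊆ interior (K (n + 1))) ∧
      (∀ x, ∃ n, x ∈ K n) ∧ ∀ n x, x ∉ interior (K (n + 1)) → ∀ L, IsCompact L →
        ¬ connectedComponentIn (K n)ᶜ x ⊆ L := by
  have step : ∀ (A : {A : Set X // IsCompact A}) (n : ℕ), ∃ B : {B : Set X // IsCompact B},
      A.1 ∪ compactCovering X n ⊆ interior B.1 ∧ ∀ x, x ∉ interior B.1 → ∀ L, IsCompact L →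
        ¬ connectedComponentIn A.1ᶜ x ⊆ L := by
    rintro ⟨A, hA⟩ n
    obtain ⟨A', hA', h⟩ := hA.exists_isCompact_component_not_subset
    obtain ⟨B, hB, hAB⟩ := exists_compact_superset
      ((hA.union (isCompact_compactCovering X n)).union hA')
    exact ⟨⟨B, hB⟩, subset_union_left.trans hAB, fun x hx => h x fun hxA => hx (hAB (Or.inr hxA))⟩
  choose next h1 h2 using step
  let K : ℕ → {A : Set X // IsCompact A} := fun n =>
    Nat.rec ⟨∅, isCompact_empty⟩ (fun n A => next A n) n
  refine ⟨fun n => (K n).1, fun n => (K n).2, fun n => subset_union_left.trans (h1 (K n) n), ?_,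
    fun n => h2 (K n) n⟩
  intro x
  obtain ⟨n, hn⟩ := mem_iUnion.1 (iUnion_compactCovering X ▸ mem_univ x)
  exact ⟨n + 1, interior_subset (h1 (K n) n (Or.inr hn))⟩

end Exhaustion

/-! ### Functions with Laplacian bounded below -/

section GlobalLaplacian

variable {E : Type*} [NormedAddCommGroup E] [NormedSpace ℂ E] [FiniteDimensional ℂ E]
  {X : Type*} [TopologicalSpace X] [T2Space X] [ChartedSpace E X] [IsManifold 𝓘(ℂ, E) ω X]
  (g : HermitianMetric E E (fun x : X => TangentSpace 𝓘(ℂ, E) x))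

theorem exists_laplacian_pos_on_compact {K N Z : Set X} (hK : IsCompact K) (hKN : Disjoint K N)
    (h : ∀ x ∈ K, ∃ v : X → ℝ, ContMDiff 𝓘(ℝ, E) 𝓘(ℝ, ℝ) ∞ v ∧ (∀ y ∈ Z, v y = 0) ∧
      (∀ y, y ∉ N → 0 ≤ hermitianLaplacian g v y) ∧ 0 < hermitianLaplacian g v x) :
    ∃ v : X → ℝ, ContMDiff 𝓘(ℝ, E) 𝓘(ℝ, ℝ) ∞ v ∧ (∀ y ∈ Z, v y = 0) ∧
      (∀ y, y ∉ N → 0 ≤ hermitianLaplacian g v y) ∧ ∀ x ∈ K, 0 < hermitianLaplacian g v x := by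
  -- The restriction `x ∉ N` makes the claim stable under unions: the induction runs over sets that
  -- may meet `N`, where the other summand has no sign.
  suffices H : ∃ v : X → ℝ, ContMDiff 𝓘(ℝ, E) 𝓘(ℝ, ℝ) ∞ v ∧ (∀ y ∈ Z, v y = 0) ∧
      (∀ y, y ∉ N → 0 ≤ hermitianLaplacian g v y) ∧
      ∀ x ∈ K, x ∉ N → 0 < hermitianLaplacian g v x by
    obtain ⟨v, h1, h2, h3, h4⟩ := H
    exact ⟨v, h1, h2, h3, fun x hx => h4 x hx (hKN.notMem_of_mem_left hx)⟩
  refine hK.induction_on (p := fun S => ∃ v : X → ℝ, ContMDiff 𝓘(ℝ, E) 𝓘(ℝ, ℝ) ∞ v ∧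
      (∀ y ∈ Z, v y = 0) ∧ (∀ y, y ∉ N → 0 ≤ hermitianLaplacian g v y) ∧
      ∀ x ∈ S, x ∉ N → 0 < hermitianLaplacian g v x) ?_ ?_ ?_ ?_
  · exact ⟨fun _ => 0, contMDiff_const, fun _ _ => rfl,
      fun y _ => (hermitianLaplacian_const g 0 y).ge, fun x hx => absurd hx (notMem_empty x)⟩
  · rintro S S' hSS' ⟨v, h1, h2, h3, h4⟩
    exact ⟨v, h1, h2, h3, fun x hx => h4 x (hSS' hx)⟩
  · rintro S S' ⟨v, h1, h2, h3, h4⟩ ⟨v', h1', h2', h3', h4'⟩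
    refine ⟨fun y => v y + v' y, h1.add h1', fun y hy => by simp [h2 y hy, h2' y hy],
      fun y hy => ?_, fun y hy hyN => ?_⟩
    · rw [hermitianLaplacian_add g (h1 y) (h1' y)]
      exact add_nonneg (h3 y hy) (h3' y hy)
    · rw [hermitianLaplacian_add g (h1 y) (h1' y)]
      rcases hy with hy | hy
      · exact add_pos_of_pos_of_nonneg (h4 y hy hyN) (h3' y hyN)
      · exact add_pos_of_nonneg_of_pos (h3 y hyN) (h4' y hy hyN)
  · intro x hx
    obtain ⟨v, h1, h2, h3, h4⟩ := h x hx
    exact ⟨{y | 0 < hermitianLaplacian g v y}, mem_nhdsWithin_of_mem_nhds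
      ((isOpen_lt continuous_const (continuous_hermitianLaplacian g h1)).mem_nhds h4),
      v, h1, h2, h3, fun y hy _ => hy⟩

theorem exists_add_mul_gt_on_compact {K : Set X} (hK : IsCompact K) {F f f' : X → ℝ}
    (hF : ContinuousOn F K) (hf : ContinuousOn f K) (hf' : ContinuousOn f' K)
    (hpos : ∀ x ∈ K, 0 < f' x) : ∃ l : ℝ, 0 ≤ l ∧ ∀ x ∈ K, F x < f x + l * f' x := by
  obtain ⟨M, hM⟩ := hK.exists_bound_of_continuousOn ((hF.sub hf).div hf' fun x hx => (hpos x hx).ne')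
  refine ⟨|M| + 1, by positivity, fun x hx => ?_⟩
  have h1 : (F x - f x) / f' x < |M| + 1 := by
    have h2 := hM x hx
    rw [Real.norm_eq_abs] at h2
    have h3 := le_abs_self ((F x - f x) / f' x)
    have h4 := le_abs_self M
    simp only [Pi.div_apply, Pi.sub_apply] at h2
    linarith
  rw [div_lt_iff₀ (hpos x hx)] at h1
  linarith

/-- On a compact connected manifold the Laplacian can be prescribed from below outside a given
nonempty open set. -/
theorem exists_laplacian_gt_of_compactSpace [CompactSpace X] [ConnectedSpace X] {N : Set X}
    (hN : IsOpen N) (hne : N.Nonempty) {F : X → ℝ} (hF : Continuous F) :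
    ∃ v : X → ℝ, ContMDiff 𝓘(ℝ, E) 𝓘(ℝ, ℝ) ∞ v ∧ ∀ x, x ∉ N → F x < hermitianLaplacian g v x := by
  have hK : IsCompact Nᶜ := hN.isClosed_compl.isCompact
  obtain ⟨v, hv1, -, -, hv4⟩ := exists_laplacian_pos_on_compact g (N := N) (Z := ∅) hK
    disjoint_compl_left fun x hx => by
      obtain ⟨v, h1, -, h3, h4⟩ := exists_pushing g isOpen_univ isPreconnected_univ hN
        (by simpa using hne) (mem_univ x) hx
      exact ⟨v, h1, fun y hy => absurd hy (notMem_empty y), h3, h4⟩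
  obtain ⟨l, -, hl⟩ := exists_add_mul_gt_on_compact hK (f := fun _ => 0) hF.continuousOn
    continuousOn_const (continuous_hermitianLaplacian g hv1).continuousOn hv4
  refine ⟨fun y => l * v y, contMDiff_const.mul hv1, fun x hx => ?_⟩
  rw [hermitianLaplacian_const_mul g l (hv1 x)]
  simpa using hl x hx

/-- For `x` in `D` outside `interior B`, the component of `Aᶜ` through `x` leaves `D`, so negativity
can be pushed into `Dᶜ` by a function supported in that component. It vanishes on `A`, and its
nonnegative Laplacian on `D` preserves the bound already known on `interior B`. -/
theorem exists_laplacian_gt_step [LocallyConnectedSpace X] {A B D : Set X} (hA : IsClosed A)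
    (hAB : A ⊆ interior B) (hD : IsCompact D)
    (hesc : ∀ x, x ∉ interior B → ¬ connectedComponentIn Aᶜ x ⊆ D)
    {F : X → ℝ} (hF : Continuous F) {u : X → ℝ} (hu : ContMDiff 𝓘(ℝ, E) 𝓘(ℝ, ℝ) ∞ u)
    (huB : ∀ x ∈ B, F x < hermitianLaplacian g u x) :
    ∃ u' : X → ℝ, ContMDiff 𝓘(ℝ, E) 𝓘(ℝ, ℝ) ∞ u' ∧ (∀ x ∈ A, u' x = u x) ∧
      ∀ x ∈ D, F x < hermitianLaplacian g u' x := by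
  have hK : IsCompact (D \ interior B) := hD.diff isOpen_interior
  obtain ⟨v, hv1, hv2, hv3, hv4⟩ := exists_laplacian_pos_on_compact g (N := Dᶜ) (Z := A) hK
    (disjoint_compl_right.mono_left sdiff_subset) fun x hx => by
      have hxA : x ∈ Aᶜ := fun h => hx.2 (hAB h)
      obtain ⟨z, hzC, hzD⟩ := not_subset.1 (hesc x hx.2)
      obtain ⟨v, h1, h2, h3, h4⟩ := exists_pushing g hA.isOpen_compl.connectedComponentIn
        isPreconnected_connectedComponentIn hD.isClosed.isOpen_compl ⟨z, hzC, hzD⟩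
        (mem_connectedComponentIn hxA) (fun h => h hx.1)
      refine ⟨v, h1, fun y hy => ?_, h3, h4⟩
      by_contra hne
      exact connectedComponentIn_subset _ _ (h2 (subset_tsupport v hne)) hy
  obtain ⟨l, hl0, hl⟩ := exists_add_mul_gt_on_compact hK hF.continuousOn
    (continuous_hermitianLaplacian g hu).continuousOn
    (continuous_hermitianLaplacian g hv1).continuousOn hv4
  refine ⟨fun y => u y + l * v y, hu.add (contMDiff_const.mul hv1),
    fun y hy => by simp [hv2 y hy], fun y hy => ?_⟩
  rw [hermitianLaplacian_add g (ψ := fun y => l * v y) (hu y) (contMDiffAt_const.mul (hv1 y)),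
    hermitianLaplacian_const_mul g l (hv1 y)]
  by_cases hyB : y ∈ interior B
  · have h1 := huB y (interior_subset hyB)
    have h2 := mul_nonneg hl0 (hv3 y fun h => h hy)
    linarith
  · exact hl y ⟨hy, hyB⟩

theorem exists_seq_laplacian_gt [LocallyConnectedSpace X] [ConnectedSpace X] [NoncompactSpace X]
    {K : ℕ → Set X} (hKc : ∀ n, IsCompact (K n)) (hKi : ∀ n, K n ⊆ interior (K (n + 1)))
    (hKe : ∀ n x, x ∉ interior (K (n + 1)) → ∀ L, IsCompact L → ¬ connectedComponentIn (K n)ᶜ x ⊆ L)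
    {F : X → ℝ} (hF : Continuous F) :
    ∃ u : ℕ → X → ℝ, (∀ n, ContMDiff 𝓘(ℝ, E) 𝓘(ℝ, ℝ) ∞ (u n)) ∧
      (∀ n, ∀ x ∈ K (n + 1), F x < hermitianLaplacian g (u n) x) ∧
      ∀ n, ∀ x ∈ K n, u (n + 1) x = u n x := by
  -- With `A = B = ∅` the step starts from the zero function: the component of any point is the
  -- noncompact space `X`.
  obtain ⟨u₀, hu₀, -, hu₀'⟩ := exists_laplacian_gt_step g (A := ∅) (B := ∅) (D := K 1) isClosed_empty
    (empty_subset _) (hKc 1) (fun x _ => connectedComponentIn_compl_empty_not_subset (hKc 1) x) hF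
    (u := fun _ => 0) contMDiff_const (fun x hx => absurd hx (notMem_empty x))
  -- The bound on `u` is a premise inside the existential, so that `next` is defined on all smooth
  -- functions; without the bound it returns `u` unchanged.
  have step : ∀ (n : ℕ) (u : {u : X → ℝ // ContMDiff 𝓘(ℝ, E) 𝓘(ℝ, ℝ) ∞ u}),
      ∃ u' : {u : X → ℝ // ContMDiff 𝓘(ℝ, E) 𝓘(ℝ, ℝ) ∞ u},
      (∀ x ∈ K (n + 1), F x < hermitianLaplacian g u.1 x) →
        (∀ x ∈ K n, u'.1 x = u.1 x) ∧ ∀ x ∈ K (n + 2), F x < hermitianLaplacian g u'.1 x := by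
    rintro n ⟨u, hu⟩
    by_cases h : ∀ x ∈ K (n + 1), F x < hermitianLaplacian g u x
    · obtain ⟨u', h1, h2, h3⟩ := exists_laplacian_gt_step g (hKc n).isClosed (hKi n) (hKc (n + 2))
        (fun x hx => hKe n x hx _ (hKc (n + 2))) hF hu h
      exact ⟨⟨u', h1⟩, fun _ => ⟨h2, h3⟩⟩
    · exact ⟨⟨u, hu⟩, fun h' => absurd h' h⟩
  choose next hnext using step
  let u : ℕ → {u : X → ℝ // ContMDiff 𝓘(ℝ, E) 𝓘(ℝ, ℝ) ∞ u} := fun n =>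
    Nat.rec ⟨u₀, hu₀⟩ (fun n u => next n u) n
  have hu : ∀ n, ∀ x ∈ K (n + 1), F x < hermitianLaplacian g (u n).1 x := by
    intro n
    induction n with
    | zero => exact hu₀'
    | succ n ih => exact (hnext n (u n) ih).2
  exact ⟨fun n => (u n).1, fun n => (u n).2, hu, fun n => (hnext n (u n) (hu n)).1⟩

/-- On a noncompact connected manifold the Laplacian can be prescribed from below. -/
theorem exists_laplacian_gt_of_noncompactSpace [SigmaCompactSpace X] [ConnectedSpace X]
    [NoncompactSpace X] {F : X → ℝ} (hF : Continuous F) :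
    ∃ v : X → ℝ, ContMDiff 𝓘(ℝ, E) 𝓘(ℝ, ℝ) ∞ v ∧ ∀ x, F x < hermitianLaplacian g v x := by
  have : LocallyConnectedSpace X := ChartedSpace.locallyConnectedSpace E X
  have : ProperSpace E := FiniteDimensional.proper ℂ E
  have : LocallyCompactSpace X := ChartedSpace.locallyCompactSpace E X
  obtain ⟨K, hKc, hKi, hKu, hKe⟩ := exists_exhaustion_component_not_subset (X := X)
  obtain ⟨u, hus, hu, hnext⟩ := exists_seq_laplacian_gt g hKc hKi hKe hF
  have hmono : Monotone K := monotone_nat_of_le_succ fun n => (hKi n).trans interior_subset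
  have heq : ∀ n x, x ∈ K n → ∀ k, u (n + k) x = u n x := by
    intro n x hx k
    induction k with
    | zero => rfl
    | succ k ih =>
      rw [← ih]
      exact hnext (n + k) x (hmono (Nat.le_add_right n k) hx)
  choose ν hν using hKu
  have hlim : ∀ n x, x ∈ K n → u (ν x) x = u n x := by
    intro n x hx
    rcases le_total n (ν x) with h | h
    · obtain ⟨k, hk⟩ := Nat.exists_eq_add_of_le h
      rw [hk]; exact heq n x hx k
    · obtain ⟨k, hk⟩ := Nat.exists_eq_add_of_le h
      rw [hk]; exact (heq (ν x) x (hν x) k).symm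
  -- The index `ν` need not be locally constant. The shift by one provides a neighbourhood of `x`
  -- inside `K (ν x + 1)`, where the sequence is constant from that index on.
  have hloc : ∀ x, (fun y => u (ν y) y) =ᶠ[𝓝 x] u (ν x + 1) := by
    intro x
    filter_upwards [isOpen_interior.mem_nhds (hKi (ν x) (hν x))] with y hy
    exact hlim _ y (interior_subset hy)
  have hsm : ContMDiff 𝓘(ℝ, E) 𝓘(ℝ, ℝ) ∞ fun y => u (ν y) y := fun x =>
    (hus (ν x + 1) x).congr_of_eventuallyEq (hloc x)
  refine ⟨fun y => u (ν y) y, hsm, fun x => ?_⟩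
  rw [hermitianLaplacian_congr g (hsm x) (hloc x)]
  exact hu _ x (hmono (by omega) (hν x))

end GlobalLaplacian

/-! ### Coordinates and Hermitian metrics in a line bundle -/

section LineBundle

variable {E : Type*} [NormedAddCommGroup E] [NormedSpace ℂ E]
  {X : Type*} [TopologicalSpace X] [ChartedSpace E X] [IsManifold 𝓘(ℂ, E) ω X]
  {L : X → Type*} [TopologicalSpace (Bundle.TotalSpace ℂ L)]
  [∀ x, AddCommGroup (L x)] [∀ x, Module ℂ (L x)] [∀ x, TopologicalSpace (L x)]
  [FiberBundle ℂ L] [VectorBundle ℂ ℂ L]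

/-- The coordinate of a vector of a line bundle in the preferred trivialization at `x₀`. -/
def lineCoord (x₀ : X) (y : X) : L y →ₗ[ℂ] ℂ := (trivializationAt ℂ L x₀).linearMapAt ℂ y

theorem lineCoord_apply {x₀ y : X} (hy : y ∈ (trivializationAt ℂ L x₀).baseSet) (v : L y) :
    lineCoord x₀ y v = (trivializationAt ℂ L x₀ ⟨y, v⟩).2 := by
  rw [lineCoord, Bundle.Trivialization.linearMapAt_apply, if_pos hy]

theorem lineCoord_localFrame {x₀ y : X} (hy : y ∈ (trivializationAt ℂ L x₀).baseSet) (c : ℂ) :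
    lineCoord x₀ y (localFrame ℂ L x₀ c y) = c := by
  rw [lineCoord, localFrame]
  exact Bundle.Trivialization.linearMapAt_symm _ hy c

theorem lineCoord_smul_localFrame {x₀ y : X} (hy : y ∈ (trivializationAt ℂ L x₀).baseSet)
    (v : L y) : lineCoord x₀ y v • localFrame ℂ L x₀ 1 y = v := by
  have hinj : Function.Injective (lineCoord (L := L) x₀ y) := fun a b hab => by
    rw [← Bundle.Trivialization.symm_linearMapAt (R := ℂ) (trivializationAt ℂ L x₀) hy a,
      ← Bundle.Trivialization.symm_linearMapAt (R := ℂ) (trivializationAt ℂ L x₀) hy b]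
    exact congrArg _ hab
  refine hinj ?_
  rw [map_smul, lineCoord_localFrame hy, smul_eq_mul, mul_one]

theorem lineCoord_ne_zero {x₀ y : X} (hy : y ∈ (trivializationAt ℂ L x₀).baseSet) {v : L y}
    (hv : v ≠ 0) : lineCoord x₀ y v ≠ 0 := fun h => hv (by
  rw [← lineCoord_smul_localFrame hy v, h, zero_smul])

theorem line_localFrame_ne_zero {x₀ y : X} (hy : y ∈ (trivializationAt ℂ L x₀).baseSet) :
    localFrame ℂ L x₀ 1 y ≠ 0 := fun h => one_ne_zero (α := ℂ) (by
  rw [← lineCoord_localFrame (L := L) hy 1, h, map_zero])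

variable [ContMDiffVectorBundle ω ℂ L 𝓘(ℂ, E)]

theorem contMDiffAt_lineCoord {s : ∀ x, L x} {x₀ x : X}
    (hx : x ∈ (trivializationAt ℂ L x₀).baseSet)
    (hs : ContMDiffAt 𝓘(ℂ, E) (𝓘(ℂ, E).prod 𝓘(ℂ, ℂ)) ω
      (fun y => (Bundle.TotalSpace.mk' ℂ y (s y) : Bundle.TotalSpace ℂ L)) x) :
    ContMDiffAt 𝓘(ℂ, E) 𝓘(ℂ, ℂ) ω (fun y => lineCoord x₀ y (s y)) x := by
  have h := ((trivializationAt ℂ L x₀).contMDiffAt_section_iff hx).1 hs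
  refine h.congr_of_eventuallyEq ?_
  filter_upwards [(trivializationAt ℂ L x₀).open_baseSet.mem_nhds hx] with y hy
  exact lineCoord_apply hy _

theorem contMDiffAt_line_localFrame {x₀ x : X} (hx : x ∈ (trivializationAt ℂ L x₀).baseSet)
    (c : ℂ) : ContMDiffAt 𝓘(ℂ, E) (𝓘(ℂ, E).prod 𝓘(ℂ, ℂ)) ω
      (fun y => (Bundle.TotalSpace.mk' ℂ y (localFrame ℂ L x₀ c y) : Bundle.TotalSpace ℂ L)) x := by
  refine ((trivializationAt ℂ L x₀).contMDiffAt_section_iff hx).2 ?_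
  refine (contMDiffAt_const (c := c)).congr_of_eventuallyEq ?_
  filter_upwards [(trivializationAt ℂ L x₀).open_baseSet.mem_nhds hx] with y hy
  rw [← lineCoord_apply hy, lineCoord_localFrame hy]

theorem HermitianMetric.normSq_smul (h : HermitianMetric E ℂ L) {x : X} (c : ℂ) (v : L x) :
    h.normSq (c • v) = Complex.normSq c * h.normSq v := by
  simp only [HermitianMetric.normSq, map_smul, LinearMap.smul_apply, map_smulₛₗ, smul_eq_mul]
  rw [← mul_assoc, mul_comm (conj c), Complex.mul_conj, Complex.re_ofReal_mul]

theorem HermitianMetric.normSq_pos (h : HermitianMetric E ℂ L) {x : X} {v : L x} (hv : v ≠ 0) :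
    0 < h.normSq v := h.pos x v hv

theorem HermitianMetric.normSq_zero (h : HermitianMetric E ℂ L) (x : X) :
    h.normSq (0 : L x) = 0 := by simp [HermitianMetric.normSq]

theorem HermitianMetric.normSq_nonneg (h : HermitianMetric E ℂ L) {x : X} (v : L x) :
    0 ≤ h.normSq v := by
  by_cases hv : v = 0
  · rw [hv, h.normSq_zero]
  · exact (h.normSq_pos hv).le

theorem HermitianMetric.contMDiffAt_normSq_localFrame (h : HermitianMetric E ℂ L) {x₀ x : X}
    (hx : x ∈ (trivializationAt ℂ L x₀).baseSet) :
    ContMDiffAt 𝓘(ℝ, E) 𝓘(ℝ, ℝ) ∞ (fun y => h.normSq (localFrame ℂ L x₀ 1 y)) x := by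
  have h1 := (h.smooth x₀ 1 1).contMDiffAt ((trivializationAt ℂ L x₀).open_baseSet.mem_nhds hx)
  exact (Complex.reCLM.contDiff (n := ∞)).contDiffAt.contMDiffAt.comp x h1

theorem HermitianMetric.normSq_eq_lineCoord (h : HermitianMetric E ℂ L) {x₀ y : X}
    (hy : y ∈ (trivializationAt ℂ L x₀).baseSet) (v : L y) :
    h.normSq v = Complex.normSq (lineCoord x₀ y v) * h.normSq (localFrame ℂ L x₀ 1 y) := by
  conv_lhs => rw [← lineCoord_smul_localFrame hy v]
  rw [h.normSq_smul]

theorem HermitianMetric.contMDiffAt_normSq (h : HermitianMetric E ℂ L) {s : ∀ x, L x} {x : X}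
    (hs : ContMDiffAt 𝓘(ℂ, E) (𝓘(ℂ, E).prod 𝓘(ℂ, ℂ)) ω
      (fun y => (Bundle.TotalSpace.mk' ℂ y (s y) : Bundle.TotalSpace ℂ L)) x) :
    ContMDiffAt 𝓘(ℝ, E) 𝓘(ℝ, ℝ) ∞ (fun y => h.normSq (s y)) x := by
  have hx := FiberBundle.mem_baseSet_trivializationAt ℂ L x
  have h1 : ContMDiffAt 𝓘(ℝ, E) 𝓘(ℝ, ℝ) ∞ (fun y => Complex.normSq (lineCoord x y (s y))) x :=
    contDiff_complex_normSq.contDiffAt.contMDiffAt.comp x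
      (contMDiffAt_lineCoord hx hs).real_of_holomorphic
  refine (h1.mul (h.contMDiffAt_normSq_localFrame hx)).congr_of_eventuallyEq ?_
  filter_upwards [(trivializationAt ℂ L x).open_baseSet.mem_nhds hx] with y hy
  exact h.normSq_eq_lineCoord hy _

theorem ContMDiffAt.real_log {φ : X → ℝ} {x : X} (hφ : ContMDiffAt 𝓘(ℝ, E) 𝓘(ℝ, ℝ) ∞ φ x)
    (h0 : φ x ≠ 0) : ContMDiffAt 𝓘(ℝ, E) 𝓘(ℝ, ℝ) ∞ (fun y => Real.log (φ y)) x :=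
  (Real.contDiffAt_log.2 h0).contMDiffAt.comp x hφ

theorem ContMDiffAt.complex_mul {φ ψ : X → ℂ} {x : X} (hφ : ContMDiffAt 𝓘(ℝ, E) 𝓘(ℝ, ℂ) ∞ φ x)
    (hψ : ContMDiffAt 𝓘(ℝ, E) 𝓘(ℝ, ℂ) ∞ ψ x) :
    ContMDiffAt 𝓘(ℝ, E) 𝓘(ℝ, ℂ) ∞ (fun y => φ y * ψ y) x := by
  have hx := mem_chart_source E x
  exact (contMDiffAt_iff_contDiffAt_chart hx).2
    (((contMDiffAt_iff_contDiffAt_chart hx).1 hφ).mul ((contMDiffAt_iff_contDiffAt_chart hx).1 hψ))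

/-- The Hermitian metric `e^{-ψ} h`. -/
def HermitianMetric.conformal (h : HermitianMetric E ℂ L) (ψ : X → ℝ)
    (hψ : ContMDiff 𝓘(ℝ, E) 𝓘(ℝ, ℝ) ∞ ψ) : HermitianMetric E ℂ L where
  form x := ((Real.exp (-ψ x) : ℝ) : ℂ) • h.form x
  conj_symm x v w := by
    simp only [LinearMap.smul_apply, smul_eq_mul, map_mul, Complex.conj_ofReal, h.conj_symm]
  pos x v hv := by
    simp only [LinearMap.smul_apply, smul_eq_mul, Complex.re_ofReal_mul]
    exact mul_pos (Real.exp_pos _) (h.pos x v hv)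
  smooth x₀ v w := by
    simp only [LinearMap.smul_apply, smul_eq_mul]
    refine fun y hy => (ContMDiffAt.complex_mul ?_ ((h.smooth x₀ v w).contMDiffAt
      ((trivializationAt ℂ L x₀).open_baseSet.mem_nhds hy))).contMDiffWithinAt
    have h1 : ContDiff ℝ ∞ fun t : ℝ => ((Real.exp (-t) : ℝ) : ℂ) :=
      Complex.ofRealCLM.contDiff.comp (Real.contDiff_exp.comp contDiff_neg)
    exact h1.contDiffAt.contMDiffAt.comp y (hψ y)

theorem HermitianMetric.conformal_normSq (h : HermitianMetric E ℂ L) (ψ : X → ℝ)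
    (hψ : ContMDiff 𝓘(ℝ, E) 𝓘(ℝ, ℝ) ∞ ψ) {x : X} (v : L x) :
    (h.conformal ψ hψ).normSq v = Real.exp (-ψ x) * h.normSq v := by
  simp only [HermitianMetric.normSq, HermitianMetric.conformal, LinearMap.smul_apply, smul_eq_mul,
    Complex.re_ofReal_mul]

end LineBundle

/-! ### The scalar curvature and its change under a conformal factor -/

section Curvature

variable {E : Type*} [NormedAddCommGroup E] [NormedSpace ℂ E] [FiniteDimensional ℂ E]
  {X : Type*} [TopologicalSpace X] [ChartedSpace E X] [IsManifold 𝓘(ℂ, E) ω X]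
  (g : HermitianMetric E E (fun x : X => TangentSpace 𝓘(ℂ, E) x))
  {L : X → Type*} [TopologicalSpace (Bundle.TotalSpace ℂ L)]
  [∀ x, AddCommGroup (L x)] [∀ x, Module ℂ (L x)] [∀ x, TopologicalSpace (L x)]
  [FiberBundle ℂ L] [VectorBundle ℂ ℂ L] [ContMDiffVectorBundle ω ℂ L 𝓘(ℂ, E)]

/-- The scalar curvature can be computed with any nonvanishing local holomorphic section. -/
theorem scalarCurvature_eq_of_section (h : HermitianMetric E ℂ L) {s : ∀ x, L x} {x : X}
    (hs : ContMDiffAt 𝓘(ℂ, E) (𝓘(ℂ, E).prod 𝓘(ℂ, ℂ)) ω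
      (fun y => (Bundle.TotalSpace.mk' ℂ y (s y) : Bundle.TotalSpace ℂ L)) x) (h0 : s x ≠ 0) :
    scalarCurvature g h x = hermitianLaplacian g (fun y => -Real.log (h.normSq (s y))) x := by
  have hx := FiberBundle.mem_baseSet_trivializationAt ℂ L x
  have hf := contMDiffAt_lineCoord hx hs
  have hf0 := lineCoord_ne_zero hx h0
  have h1 : ContMDiffAt 𝓘(ℝ, E) 𝓘(ℝ, ℝ) ∞
      (fun y => -Real.log (h.normSq (localFrame ℂ L x 1 y))) x :=
    ((h.contMDiffAt_normSq_localFrame hx).real_log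
      (h.normSq_pos (line_localFrame_ne_zero hx)).ne').neg
  have h2 : ContMDiffAt 𝓘(ℝ, E) 𝓘(ℝ, ℝ) ∞ (fun y => -Real.log (h.normSq (s y))) x :=
    ((h.contMDiffAt_normSq hs).real_log (h.normSq_pos h0).ne').neg
  have h3 := contMDiffAt_log_normSq hf hf0
  have e : (fun y => -Real.log (h.normSq (s y))) =ᶠ[𝓝 x]
      fun y => (-1) * Real.log (Complex.normSq (lineCoord x y (s y)))
        + -Real.log (h.normSq (localFrame ℂ L x 1 y)) := by
    filter_upwards [(trivializationAt ℂ L x).open_baseSet.mem_nhds hx,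
      hf.continuousAt.eventually_ne hf0] with y hy hy0
    rw [h.normSq_eq_lineCoord hy (s y), Real.log_mul (by simpa using hy0)
      (h.normSq_pos (line_localFrame_ne_zero hy)).ne']
    ring
  rw [hermitianLaplacian_congr g h2 e,
    hermitianLaplacian_add g (φ := fun y => (-1) * Real.log (Complex.normSq (lineCoord x y (s y))))
      (contMDiffAt_const.mul h3) h1,
    hermitianLaplacian_const_mul g (-1) h3, hermitianLaplacian_log_normSq g hf hf0]
  simp [scalarCurvature]

/-- The definition uses a different frame at each point; near `x` the single frame at `x` serves,
because the curvature does not depend on the section. -/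
theorem continuous_scalarCurvature (h : HermitianMetric E ℂ L) :
    Continuous (scalarCurvature g h) := by
  refine continuous_iff_continuousAt.2 fun x => ?_
  have hx := FiberBundle.mem_baseSet_trivializationAt ℂ L x
  have ho := (trivializationAt ℂ L x).open_baseSet
  have hsm : ContMDiffOn 𝓘(ℝ, E) 𝓘(ℝ, ℝ) ∞
      (fun y => -Real.log (h.normSq (localFrame ℂ L x 1 y))) (trivializationAt ℂ L x).baseSet :=
    fun y hy => (((h.contMDiffAt_normSq_localFrame hy).real_log
      (h.normSq_pos (line_localFrame_ne_zero hy)).ne').neg).contMDiffWithinAt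
  refine ((continuousOn_hermitianLaplacian g ho hsm).continuousAt (ho.mem_nhds hx)).congr ?_
  filter_upwards [ho.mem_nhds hx] with y hy
  exact (scalarCurvature_eq_of_section g h (contMDiffAt_line_localFrame hy 1)
    (line_localFrame_ne_zero hy)).symm

theorem scalarCurvature_conformal (h : HermitianMetric E ℂ L) {ψ : X → ℝ}
    (hψ : ContMDiff 𝓘(ℝ, E) 𝓘(ℝ, ℝ) ∞ ψ) (x : X) :
    scalarCurvature g (h.conformal ψ hψ) x = scalarCurvature g h x + hermitianLaplacian g ψ x := by
  have hx := FiberBundle.mem_baseSet_trivializationAt ℂ L x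
  have h1 : ContMDiffAt 𝓘(ℝ, E) 𝓘(ℝ, ℝ) ∞
      (fun y => -Real.log (h.normSq (localFrame ℂ L x 1 y))) x :=
    ((h.contMDiffAt_normSq_localFrame hx).real_log
      (h.normSq_pos (line_localFrame_ne_zero hx)).ne').neg
  have h2 : ContMDiffAt 𝓘(ℝ, E) 𝓘(ℝ, ℝ) ∞
      (fun y => -Real.log (h.normSq (localFrame ℂ L x 1 y)) + ψ y) x := h1.add (hψ x)
  rw [scalarCurvature, scalarCurvature, ← hermitianLaplacian_add g h1 (hψ x)]
  symm
  refine hermitianLaplacian_congr g h2 ?_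
  filter_upwards [(trivializationAt ℂ L x).open_baseSet.mem_nhds hx] with y hy
  rw [h.conformal_normSq, Real.log_mul (Real.exp_ne_zero _)
    (h.normSq_pos (line_localFrame_ne_zero hy)).ne', Real.log_exp]
  ring

/-- Every holomorphic line bundle has a smooth Hermitian metric. -/
theorem exists_hermitianMetric [T2Space X] [SigmaCompactSpace X] :
    Nonempty (HermitianMetric E ℂ L) := by
  obtain ⟨ρ, hρ⟩ := SmoothPartitionOfUnity.exists_isSubordinate 𝓘(ℝ, E) (isClosed_univ (X := X))
    (fun x => (trivializationAt ℂ L x).baseSet) (fun x => (trivializationAt ℂ L x).open_baseSet)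
    (fun x _ => mem_iUnion.2 ⟨x, FiberBundle.mem_baseSet_trivializationAt ℂ L x⟩)
  -- `B i` is the flat metric of the `i`-th trivialization; off its base set it is a junk value,
  -- which the weight `ρ i` kills.
  let B : ∀ (i y : X), L y →ₗ[ℂ] L y →ₗ⋆[ℂ] ℂ := fun i y =>
    LinearMap.mk₂'ₛₗ (RingHom.id ℂ) (starRingEnd ℂ)
      (fun v w => lineCoord i y v * conj (lineCoord i y w))
      (fun a b c => by rw [map_add, add_mul]) (fun c a b => by simp [mul_assoc])
      (fun a b c => by rw [map_add, map_add, mul_add]) (fun c a b => by simp; ring)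
  have hB : ∀ i y v w, B i y v w = lineCoord i y v * conj (lineCoord i y w) := fun _ _ _ _ => rfl
  have hform : ∀ y v w, (∑ i ∈ ρ.finsupport y, ((ρ i y : ℝ) : ℂ) • B i y) v w
      = ∑ i ∈ ρ.finsupport y, ρ i y • (lineCoord i y v * conj (lineCoord i y w)) := by
    intro y v w
    simp only [LinearMap.sum_apply, LinearMap.smul_apply, hB, smul_eq_mul, Complex.real_smul]
  refine ⟨⟨fun y => ∑ i ∈ ρ.finsupport y, ((ρ i y : ℝ) : ℂ) • B i y, ?_, ?_, ?_⟩⟩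
  · intro y v w
    rw [hform, hform, map_sum]
    refine Finset.sum_congr rfl fun i _ => ?_
    simp only [Complex.real_smul, map_mul, Complex.conj_ofReal, Complex.conj_conj]
    ring
  · intro y v hv
    rw [hform, Complex.re_sum]
    have e : ∀ i, (ρ i y • (lineCoord i y v * conj (lineCoord i y v))).re
        = ρ i y * Complex.normSq (lineCoord i y v) := fun i => by
      rw [Complex.mul_conj, Complex.real_smul, ← Complex.ofReal_mul, Complex.ofReal_re]
    simp only [e]
    obtain ⟨i, hi⟩ := ρ.exists_pos_of_mem (mem_univ y)
    refine Finset.sum_pos' (fun j _ => mul_nonneg (ρ.nonneg j y) (Complex.normSq_nonneg _))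
      ⟨i, (ρ.mem_finsupport y).2 hi.ne', mul_pos hi (Complex.normSq_pos.2 ?_)⟩
    exact lineCoord_ne_zero (hρ i (subset_tsupport _ hi.ne')) hv
  · intro x₀ v w y hy
    refine ContMDiffAt.contMDiffWithinAt ?_
    simp only [hform]
    have e : ∀ y, ∑ i ∈ ρ.finsupport y, ρ i y • (lineCoord i y (localFrame ℂ L x₀ v y)
        * conj (lineCoord i y (localFrame ℂ L x₀ w y)))
        = ∑ᶠ i, ρ i y • (lineCoord i y (localFrame ℂ L x₀ v y)
        * conj (lineCoord i y (localFrame ℂ L x₀ w y))) := fun y =>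
      ρ.sum_finsupport_smul_eq_finsum y fun i y => lineCoord i y (localFrame ℂ L x₀ v y)
        * conj (lineCoord i y (localFrame ℂ L x₀ w y))
    simp only [e]
    refine ρ.contMDiffAt_finsum fun i hi => ?_
    have hyi := hρ i hi
    have h1 : ∀ c : ℂ, ContMDiffAt 𝓘(ℝ, E) 𝓘(ℝ, ℂ) ∞
        (fun y => lineCoord i y (localFrame ℂ L x₀ c y)) y := fun c =>
      (contMDiffAt_lineCoord hyi (contMDiffAt_line_localFrame hy c)).real_of_holomorphic
    have h2 : ContMDiffAt 𝓘(ℝ, E) 𝓘(ℝ, ℂ) ∞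
        (fun y => conj (lineCoord i y (localFrame ℂ L x₀ w y))) y :=
      (Complex.conjCLE.contDiff (n := ∞)).contDiffAt.contMDiffAt.comp y (h1 w)
    exact (h1 v).complex_mul h2

end Curvature

/-! ### Metrics of positive curvature -/

section PositiveCurvature

variable {E : Type*} [NormedAddCommGroup E] [NormedSpace ℂ E] [FiniteDimensional ℂ E]
  {X : Type*} [TopologicalSpace X] [T2Space X] [ChartedSpace E X] [IsManifold 𝓘(ℂ, E) ω X]
  (g : HermitianMetric E E (fun x : X => TangentSpace 𝓘(ℂ, E) x))
  {L : X → Type*} [TopologicalSpace (Bundle.TotalSpace ℂ L)]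
  [∀ x, AddCommGroup (L x)] [∀ x, Module ℂ (L x)] [∀ x, TopologicalSpace (L x)]
  [FiberBundle ℂ L] [VectorBundle ℂ ℂ L] [ContMDiffVectorBundle ω ℂ L 𝓘(ℂ, E)]

/-- The canonical section of the line bundle associated to an effective divisor. -/
theorem EffectiveDivisor.IsAssociatedLineBundle.exists_section [Nonempty X]
    {D : EffectiveDivisor E X} (hD : D.IsAssociatedLineBundle L) :
    ∃ s : ∀ x, L x, IsHolomorphicSectionOn E s Set.univ ∧ (∃ x, s x ≠ 0) ∧
      ∀ x ∈ D.support, s x = 0 := by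
  obtain ⟨e, he, he0, hee⟩ := hD
  -- The section is defined pointwise with a frame that varies with `z`; the transition rule shows
  -- that on `D.U x` it equals `f x • e x`, which is holomorphic.
  have hs : ∀ x, ∀ z ∈ D.U x, D.f z z • e z z = D.f x z • e x z := by
    intro x z hz
    have hm : z ∈ D.U x ∩ D.U z := ⟨hz, D.mem_U z⟩
    rw [hee x z z hm, D.f_eq x z z hm, smul_smul, mul_comm]
  refine ⟨fun z => D.f z z • e z z, ?_, ?_, fun x hx => ?_⟩
  · intro x _
    refine ContMDiffAt.contMDiffWithinAt ?_
    have hn := (D.isOpen_U x).mem_nhds (D.mem_U x)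
    have hx := FiberBundle.mem_baseSet_trivializationAt ℂ L x
    have h1 := contMDiffAt_lineCoord hx ((he x).contMDiffAt hn)
    have h2 := (D.holomorphic_f x).contMDiffAt hn
    refine ((trivializationAt ℂ L x).contMDiffAt_section_iff hx).2 ?_
    refine (h2.mul h1).congr_of_eventuallyEq ?_
    filter_upwards [hn, (trivializationAt ℂ L x).open_baseSet.mem_nhds hx] with z hz hzb
    rw [hs x z hz, ← lineCoord_apply hzb, map_smul]
    rfl
  · obtain ⟨x⟩ := ‹Nonempty X›
    obtain ⟨z, hz, hfz⟩ := D.exists_ne_zero x (D.U x) subset_rfl (D.isOpen_U x) ⟨x, D.mem_U x⟩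
    refine ⟨z, ?_⟩
    simp only [hs x z hz]
    exact smul_ne_zero hfz (he0 x z hz)
  · have : D.f x x = 0 := hx
    simp [this]

theorem exists_scalarCurvature_pos_of_noncompactSpace [SigmaCompactSpace X] [ConnectedSpace X]
    [NoncompactSpace X] : ∃ h : HermitianMetric E ℂ L, ∀ x, 0 < scalarCurvature g h x := by
  obtain ⟨h⟩ := exists_hermitianMetric (E := E) (L := L)
  obtain ⟨v, hv, hv'⟩ := exists_laplacian_gt_of_noncompactSpace g
    (continuous_scalarCurvature g h).neg
  refine ⟨h.conformal v hv, fun x => ?_⟩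
  rw [scalarCurvature_conformal]
  have h1 : -scalarCurvature g h x < hermitianLaplacian g v x := hv' x
  linarith

theorem exists_bounded_laplacian_pos [CompactSpace X] [ConnectedSpace X] {N : Set X}
    (hN : IsOpen N) (hne : N.Nonempty) :
    ∃ v : X → ℝ, ContMDiff 𝓘(ℝ, E) 𝓘(ℝ, ℝ) ∞ v ∧ (∀ x, |v x| ≤ 1) ∧
      ∀ x, x ∉ N → 0 < hermitianLaplacian g v x := by
  obtain ⟨v, hv, hv'⟩ := exists_laplacian_gt_of_compactSpace g hN hne (F := fun _ => 0)
    continuous_const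
  obtain ⟨B, hB⟩ := isCompact_univ.exists_bound_of_continuousOn hv.continuous.continuousOn
  have hB0 : 0 < |B| + 1 := by positivity
  refine ⟨fun y => (|B| + 1)⁻¹ * v y, contMDiff_const.mul hv, fun x => ?_, fun x hx => ?_⟩
  · have h1 := hB x (mem_univ x)
    rw [Real.norm_eq_abs] at h1
    rw [abs_mul, abs_of_pos (inv_pos.2 hB0), inv_mul_le_iff₀ hB0]
    have := le_abs_self B
    linarith
  · rw [hermitianLaplacian_const_mul g _ (hv x)]
    exact mul_pos (inv_pos.2 hB0) (hv' x hx)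

/-- If the curvature of `h` is positive outside a set on which `s` is bounded away from zero, then
`h` can be modified to a metric of positive curvature with the help of a section with zeros. -/
theorem exists_scalarCurvature_pos_of_pos_outside [CompactSpace X] [ConnectedSpace X]
    {s : ∀ x, L x} (hs : IsHolomorphicSectionOn E s Set.univ) (hs0 : ∃ x, s x = 0)
    (h : HermitianMetric E ℂ L) {M : ℝ}
    (hM : ∀ x, scalarCurvature g h x ≤ 0 → s x ≠ 0 ∧ |Real.log (h.normSq (s x))| ≤ M) :
    ∃ h' : HermitianMetric E ℂ L, ∀ x, 0 < scalarCurvature g h' x := by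
  classical
  have hsx : ∀ x, ContMDiffAt 𝓘(ℂ, E) (𝓘(ℂ, E).prod 𝓘(ℂ, ℂ)) ω
      (fun y => (Bundle.TotalSpace.mk' ℂ y (s y) : Bundle.TotalSpace ℂ L)) x :=
    fun x => hs.contMDiffAt univ_mem
  set σ : X → ℝ := fun y => h.normSq (s y) with hσ
  have hσs : ContMDiff 𝓘(ℝ, E) 𝓘(ℝ, ℝ) ∞ σ := fun x => h.contMDiffAt_normSq (hsx x)
  -- Since `|v| ≤ 1`, this gives `t ≥ C - M - 1 = 1` wherever the curvature is nonpositive, so the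
  -- ramp has slope one there. On `N` one has `t < 1 + C - C - 1 = 0`, so the ramp vanishes near the
  -- zeros of `s`.
  set C : ℝ := M + 2 with hC
  set N : Set X := {y | σ y < Real.exp (-C - 1)} with hN
  have hNo : IsOpen N := isOpen_lt hσs.continuous continuous_const
  have hNne : N.Nonempty := by
    obtain ⟨p, hp⟩ := hs0
    refine ⟨p, ?_⟩
    simp only [hN, hσ, mem_ofPred_eq, hp, h.normSq_zero]
    exact Real.exp_pos _
  obtain ⟨v, hv, hv1, hvN⟩ := exists_bounded_laplacian_pos g hNo hNne
  set t : X → ℝ := fun y => v y + (C + Real.log (σ y)) with ht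
  set θ : X → ℝ := fun y => if s y = 0 then 0 else smoothRamp (t y) with hθ
  have hσpos : ∀ y, s y ≠ 0 → 0 < σ y := fun y hy => h.normSq_pos hy
  have hθN : ∀ y ∈ N, θ y = 0 := by
    intro y hy
    by_cases hsy : s y = 0
    · simp only [hθ, if_pos hsy]
    · simp only [hθ, if_neg hsy]
      refine smoothRamp_of_nonpos ?_
      have h1 : Real.log (σ y) < -C - 1 := (Real.log_lt_iff_lt_exp (hσpos y hsy)).2 hy
      have h2 := (abs_le.1 (hv1 y)).2
      simp only [ht]; linarith
  have hsN : ∀ y, y ∉ N → s y ≠ 0 := by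
    intro y hy h0
    refine hy ?_
    simp only [hN, hσ, mem_ofPred_eq, h0, h.normSq_zero]
    exact Real.exp_pos _
  have hlog : ∀ y, s y ≠ 0 → ContMDiffAt 𝓘(ℝ, E) 𝓘(ℝ, ℝ) ∞ (fun y => Real.log (σ y)) y :=
    fun y hy => (hσs y).real_log (hσpos y hy).ne'
  have hts : ∀ y, s y ≠ 0 → ContMDiffAt 𝓘(ℝ, E) 𝓘(ℝ, ℝ) ∞ t y :=
    fun y hy => (hv y).add (contMDiffAt_const.add (hlog y hy))
  have hθt : ∀ y, s y ≠ 0 → θ =ᶠ[𝓝 y] fun y => smoothRamp (t y) := by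
    intro y hy
    filter_upwards [(hσs.continuous.isOpen_preimage _ isOpen_Ioi).mem_nhds
      (show y ∈ σ ⁻¹' Ioi 0 from hσpos y hy)] with z hz
    have hsz : s z ≠ 0 := by
      intro h0
      have : (0 : ℝ) < h.normSq (s z) := hz
      rw [h0, h.normSq_zero] at this
      exact lt_irrefl _ this
    simp only [hθ, if_neg hsz]
  have hθs : ContMDiff 𝓘(ℝ, E) 𝓘(ℝ, ℝ) ∞ θ := by
    intro y
    by_cases hy : y ∈ N
    · refine (contMDiffAt_const (c := (0 : ℝ))).congr_of_eventuallyEq ?_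
      filter_upwards [hNo.mem_nhds hy] with z hz using hθN z hz
    · have h1 : ContMDiffAt 𝓘(ℝ, E) 𝓘(ℝ, ℝ) ∞ (fun y => smoothRamp (t y)) y :=
        contDiff_smoothRamp.contDiffAt.contMDiffAt.comp y (hts y (hsN y hy))
      exact h1.congr_of_eventuallyEq (hθt y (hsN y hy))
  refine ⟨h.conformal θ hθs, fun x => ?_⟩
  rw [scalarCurvature_conformal]
  by_cases hx : x ∈ N
  · have h1 : θ =ᶠ[𝓝 x] fun _ => 0 := by
      filter_upwards [hNo.mem_nhds hx] with z hz using hθN z hz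
    rw [hermitianLaplacian_congr g (hθs x) h1, hermitianLaplacian_const, add_zero]
    -- A point with nonpositive curvature has `log σ ≥ -M`, above the threshold `-C - 1` that
    -- defines `N`.
    by_contra hneg
    obtain ⟨h2, h3⟩ := hM x (not_lt.1 hneg)
    have h4 : Real.log (σ x) < -C - 1 := (Real.log_lt_iff_lt_exp (hσpos x h2)).2 hx
    have h5 := (abs_le.1 h3).1
    change -M ≤ Real.log (σ x) at h5
    linarith [(abs_nonneg _).trans h3]
  · have hsx0 := hsN x hx
    have hlapt : hermitianLaplacian g t x = hermitianLaplacian g v x - scalarCurvature g h x := by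
      have h1 : ContMDiffAt 𝓘(ℝ, E) 𝓘(ℝ, ℝ) ∞ (fun y => -Real.log (σ y)) x := (hlog x hsx0).neg
      have h2 : hermitianLaplacian g (fun y => Real.log (σ y)) x = - scalarCurvature g h x := by
        rw [scalarCurvature_eq_of_section g h (hsx x) hsx0]
        have h3 := hermitianLaplacian_const_mul g (-1) (hlog x hsx0)
        simp only [neg_mul, one_mul] at h3
        rw [h3, neg_neg]
      have h3 : hermitianLaplacian g (fun y => C + Real.log (σ y)) x
          = - scalarCurvature g h x := by
        rw [hermitianLaplacian_add g (φ := fun _ => C) contMDiffAt_const (hlog x hsx0),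
          hermitianLaplacian_const, h2, zero_add]
      rw [hermitianLaplacian_add g (ψ := fun y => C + Real.log (σ y)) (hv x)
        (contMDiffAt_const.add (hlog x hsx0)), h3]
      ring
    have hle : Real.smoothTransition (t x) * hermitianLaplacian g t x
        ≤ hermitianLaplacian g θ x := by
      rw [hermitianLaplacian_congr g (hθs x) (hθt x hsx0), ← deriv_smoothRamp]
      exact le_hermitianLaplacian_comp g contDiff_smoothRamp (hts x hsx0)
        (deriv_deriv_smoothRamp_nonneg _)
    -- The new curvature is now at least `(1 - T) R_h + T Δv` with `T = smoothTransition (t x)` in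
    -- `[0, 1]` and `Δv > 0`. If `R_h ≤ 0` then `T = 1`; if `R_h > 0` the sum is positive for every
    -- such `T`.
    rw [hlapt] at hle
    have hvx := hvN x hx
    have hT0 := Real.smoothTransition.nonneg (t x)
    have hT1 := Real.smoothTransition.le_one (t x)
    by_cases hR : scalarCurvature g h x ≤ 0
    · have h1 : 1 ≤ t x := by
        have h2 := (abs_le.1 (hM x hR).2).1
        change -M ≤ Real.log (σ x) at h2
        have h3 := (abs_le.1 (hv1 x)).1
        simp only [ht]; linarith
      rw [Real.smoothTransition.one_of_one_le h1] at hle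
      linarith
    · rw [not_le] at hR
      rcases hT0.eq_or_lt with h1 | h1
      · rw [← h1] at hle
        linarith
      · have h2 := mul_pos h1 hvx
        have h3 := mul_nonneg (sub_nonneg.2 hT1) hR.le
        nlinarith

/-- A first conformal change moves all nonpositive curvature into a compact neighbourhood of a point
where `s ≠ 0`. On it `log|s|²` is bounded, which is what the second change, through
`exists_scalarCurvature_pos_of_pos_outside`, requires. -/
theorem exists_scalarCurvature_pos_of_section [CompactSpace X] [ConnectedSpace X]
    {s : ∀ x, L x} (hs : IsHolomorphicSectionOn E s Set.univ) (hne : ∃ x, s x ≠ 0)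
    (hs0 : ∃ x, s x = 0) : ∃ h : HermitianMetric E ℂ L, ∀ x, 0 < scalarCurvature g h x := by
  obtain ⟨h₀⟩ := exists_hermitianMetric (E := E) (L := L)
  obtain ⟨q, hq⟩ := hne
  have hcont : ∀ h : HermitianMetric E ℂ L, Continuous fun y => h.normSq (s y) := fun h =>
    continuous_iff_continuousAt.2 fun x =>
      (h.contMDiffAt_normSq (hs.contMDiffAt univ_mem)).continuousAt
  have hUo : IsOpen {y | 0 < h₀.normSq (s y)} := isOpen_lt continuous_const (hcont h₀)
  obtain ⟨N, hNo, hqN, hNc⟩ := exists_mem_nhds_isClosed_subset (hUo.mem_nhds (h₀.normSq_pos hq))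
  have hN0 : ∀ y ∈ N, s y ≠ 0 := by
    intro y hy h0
    have : 0 < h₀.normSq (s y) := hNc hy
    rw [h0, h₀.normSq_zero] at this
    exact lt_irrefl _ this
  obtain ⟨v, hv, hvN⟩ := exists_laplacian_gt_of_compactSpace g (N := interior N) isOpen_interior
    ⟨q, mem_interior_iff_mem_nhds.2 hNo⟩ (continuous_scalarCurvature g h₀).neg
  set h := h₀.conformal v hv with hh
  obtain ⟨M, hM⟩ := hqN.isCompact.exists_bound_of_continuousOn
    (f := fun y => Real.log (h.normSq (s y)))
    ((hcont h).continuousOn.log fun y hy => (h.normSq_pos (hN0 y hy)).ne')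
  refine exists_scalarCurvature_pos_of_pos_outside g hs hs0 h (M := M) fun x hx => ?_
  have hxN : x ∈ N := by
    by_contra hxN
    have h1 : -scalarCurvature g h₀ x < hermitianLaplacian g v x :=
      hvN x fun h => hxN (interior_subset h)
    rw [hh, scalarCurvature_conformal] at hx
    linarith
  exact ⟨hN0 x hxN, hM x hxN⟩

end PositiveCurvature

end

theorem theorem2p3
    {E : Type*} [NormedAddCommGroup E] [NormedSpace ℂ E] [FiniteDimensional ℂ E]
    {X : Type*} [TopologicalSpace X] [T2Space X] [SecondCountableTopology X] [ConnectedSpace X]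
    [ChartedSpace E X] [IsManifold 𝓘(ℂ, E) ω X]
    (g : HermitianMetric E E (fun x : X => TangentSpace 𝓘(ℂ, E) x))
    (L : X → Type*) [TopologicalSpace (Bundle.TotalSpace ℂ L)]
    [∀ x, AddCommGroup (L x)] [∀ x, Module ℂ (L x)] [∀ x, TopologicalSpace (L x)]
    [FiberBundle ℂ L] [VectorBundle ℂ ℂ L] [ContMDiffVectorBundle ω ℂ L 𝓘(ℂ, E)]
    (hL : NoncompactSpace X ∨
      (∃ D : EffectiveDivisor E X, D.support.Nonempty ∧ D.IsAssociatedLineBundle L) ∨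
      (∃ s : ∀ x, L x, IsHolomorphicSectionOn E s Set.univ ∧ (∃ x, s x ≠ 0) ∧ ∃ x, s x = 0)) :
    ∃ h : HermitianMetric E ℂ L, ∀ x, 0 < scalarCurvature g h x := by
  have : ProperSpace E := FiniteDimensional.proper ℂ E
  have : LocallyCompactSpace X := ChartedSpace.locallyCompactSpace E X
  by_cases hX : CompactSpace X
  swap
  · have : NoncompactSpace X := not_compactSpace_iff.1 hX
    exact exists_scalarCurvature_pos_of_noncompactSpace g
  · have hs : ∃ s : ∀ x, L x, IsHolomorphicSectionOn E s Set.univ ∧ (∃ x, s x ≠ 0) ∧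
        ∃ x, s x = 0 := by
      rcases hL with h | ⟨D, ⟨x, hx⟩, hD⟩ | h
      · exact absurd (isCompact_univ (X := X)) (noncompact_univ X)
      · obtain ⟨s, h1, h2, h3⟩ := hD.exists_section
        exact ⟨s, h1, h2, x, h3 x hx⟩
      · exact h
    obtain ⟨s, h1, h2, h3⟩ := hs
    exact exists_scalarCurvature_pos_of_section g h1 h2 h3
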